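/- Let $\ell>2$ be a prime number. For an integer $s\ge 0$ let $\mathcal{B}_\ell(s)=\{x\in \mathrm{SL}_2(\mathbb{Z}_\ell) : x\equiv \mathrm{Id} \pmod{\ell^s}\}$, and put $\mathcal{B}_\ell(s,t)=\mathcal{B}_\ell(s)\times\mathcal{B}_\ell(t)\subseteq \mathrm{SL}_2(\mathbb{Z}_\ell)^2$. For an open subgroup $T$ of $\mathrm{SL}_2(\mathbb{Z}_\ell)^2$ let $T'$ be its derived (commutator) subgroup, and let $\mathcal{L}(T)\subseteq \mathfrak{sl}_2(\mathbb{Z}_\ell)\oplus\mathfrak{sl}_2(\mathbb{Z}_\ell)$ be the $\mathbb{Z}_\ell$-span of the elements $\left(t_1-\tfrac12\operatorname{tr}(t_1)\,\mathrm{Id},\ t_2-\tfrac12\operatorname{tr}(t_2)\,\mathrm{Id}\right)$ for $(t_1,t_2)\in T$. For $x\in\mathrm{SL}_2(\mathbb{Z}_\ell)$ write $[x]$ for its reduction in $\mathrm{SL}_2(\mathbb{F}_\ell)$. Let $G$ be an open subgroup of $\mathrm{SL}_2(\mathbb{Z}_\ell)^2$ with projections $G_1,G_2$ on the two factors, and for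 $i=1,2$ let $n_i$ be a positive integer such that $G_i\supseteq\mathcal{B}_\ell(n_i)$. Then at least one of the following holds: 1. $G'$ contains $\mathcal{B}_\ell(20\max\{n_1,n_2\},\,20\max\{n_1,n_2\})$; 2. there exists an open subgroup $T$ of $G$, of index dividing $48^2$, with the following two properties: (a) for every integer $k\ge 0$, if $\mathcal{L}(T)$ contains $\ell^k\mathfrak{sl}_2(\mathbb{Z}_\ell)\oplus\ell^k\mathfrak{sl}_2(\mathbb{Z}_\ell)$, then $T'$ contains $\mathcal{B}_\ell(p,p)$, where $p=2k+\max\{2k,8n_1,8n_2\}$; (b) for every $(t_1,t_2)\in T$, if both $[t_1]$ and $[t_2]$ are multiples of the identity, then $[t_1]=[t_2]$. -/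

import Mathlib

open scoped MatrixGroups Pointwise

namespace PinkSL2

/-- `𝓑_ℓ(s)`: the matrices of `SL₂(ℤ_ℓ)` congruent to the identity modulo `ℓ ^ s`.
For `s = 0` this is all of `SL₂(ℤ_ℓ)`. -/
noncomputable def ball (ℓ : ℕ) [Fact ℓ.Prime] (s : ℕ) : Subgroup SL(2, ℤ_[ℓ]) :=
  (Matrix.SpecialLinearGroup.map (n := Fin 2) (PadicInt.toZModPow (p := ℓ) s)).ker

/-- `𝓑_ℓ(s₁, s₂) = 𝓑_ℓ(s₁) × 𝓑_ℓ(s₂)`. -/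
noncomputable def ball₂ (ℓ : ℕ) [Fact ℓ.Prime] (s₁ s₂ : ℕ) : Subgroup (SL(2, ℤ_[ℓ]) × SL(2, ℤ_[ℓ])) :=
  (ball ℓ s₁).prod (ball ℓ s₂)

/-- `Θ₁(g) = g - (1/2) tr(g) · Id`. For odd `ℓ` the element `2` is a unit of `ℤ_ℓ` and
`Ring.inverse 2` is its inverse. -/
noncomputable def theta₁ (ℓ : ℕ) [Fact ℓ.Prime] (g : SL(2, ℤ_[ℓ])) :
    Matrix (Fin 2) (Fin 2) ℤ_[ℓ] :=
  (g : Matrix (Fin 2) (Fin 2) ℤ_[ℓ]) -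
    (Ring.inverse (2 : ℤ_[ℓ]) * (g : Matrix (Fin 2) (Fin 2) ℤ_[ℓ]).trace) • 1

/-- `Θ₂(g₁, g₂) = (Θ₁(g₁), Θ₁(g₂))`. -/
noncomputable def theta₂ (ℓ : ℕ) [Fact ℓ.Prime] (g : SL(2, ℤ_[ℓ]) × SL(2, ℤ_[ℓ])) :
    Matrix (Fin 2) (Fin 2) ℤ_[ℓ] × Matrix (Fin 2) (Fin 2) ℤ_[ℓ] :=
  (theta₁ ℓ g.1, theta₁ ℓ g.2)

/-- `𝓛(T)`: the `ℤ_ℓ`-span of `Θ₂(T)`. -/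
noncomputable def lieAlg (ℓ : ℕ) [Fact ℓ.Prime] (T : Subgroup (SL(2, ℤ_[ℓ]) × SL(2, ℤ_[ℓ]))) :
    Submodule ℤ_[ℓ] (Matrix (Fin 2) (Fin 2) ℤ_[ℓ] × Matrix (Fin 2) (Fin 2) ℤ_[ℓ]) :=
  Submodule.span ℤ_[ℓ] (theta₂ ℓ '' (T : Set (SL(2, ℤ_[ℓ]) × SL(2, ℤ_[ℓ]))))

/-- `ℓ ^ k 𝔰𝔩₂(ℤ_ℓ)`, where `𝔰𝔩₂(ℤ_ℓ)` is the module of `2 × 2` matrices of trace `0`. -/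
noncomputable def scaledSl (ℓ : ℕ) [Fact ℓ.Prime] (k : ℕ) :
    Submodule ℤ_[ℓ] (Matrix (Fin 2) (Fin 2) ℤ_[ℓ]) :=
  ((ℓ : ℤ_[ℓ]) ^ k) • LinearMap.ker (Matrix.traceLinearMap (Fin 2) ℤ_[ℓ] ℤ_[ℓ])

/-- The reduction `[x]` modulo `ℓ` of an element of `SL₂(ℤ_ℓ)`. -/
noncomputable def red (ℓ : ℕ) [Fact ℓ.Prime] : SL(2, ℤ_[ℓ]) →* SL(2, ZMod ℓ) :=
  Matrix.SpecialLinearGroup.map (n := Fin 2) (PadicInt.toZMod (p := ℓ))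

/-- The matrix `x` is a multiple of the identity. -/
def IsScalar {ℓ : ℕ} (x : SL(2, ZMod ℓ)) : Prop :=
  ∃ c : ZMod ℓ, (x : Matrix (Fin 2) (Fin 2) (ZMod ℓ)) = c • 1

end PinkSL2

/-! Let `N` be the congruence kernel `G ⊓ ball₂ ℓ 1 1`, let `n = max n₁ n₂` and `m = n + 1`, and let
`ℓ ^ e` be the exact precision to which the half-traces of the two components agree on `N`. The two
alternatives correspond to `e` being small or large compared with `n`.

Whatever `e` is, `N` contains a ball of radius `e + 2m`. Since `Θ(xz) + Θ(x⁻¹z) = 2 τ(x) Θ(z)`, the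
module `𝓛(N)` is stable under the componentwise action of half-traces (`act_tau_mem_lieAlg`). An `x`
realising the precision `e` therefore separates the two factors, and `[𝓛(N), 𝓛(N)]` contains `ℓ ^ (e
+ 2m)` times all traceless pairs. By Pink's theorem (`mem_of_theta₂_mem`), `N` contains each element
of `𝓑(1, 1)` whose `Θ` lies there. Commutators of this ball with unipotent elements of the
projections then fill a slightly smaller ball (`ball_le_comap_commutator`). For small `e` this gives
the first alternative.

For large `e`, the algebra `A` spanned by `N` has nearly equal traces in its two components, so
modulo a high power of `ℓ` it resembles the graph of an isomorphism. Conjugation by `t ∈ G`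
preserves `A`; an element of `A` with first component `ℓ ^ m t₁` must then have second component
close to `± ℓ ^ m t₂`, by a centraliser and determinant argument. The sign is a character of `G`,
and `T` is its kernel, of index at most 2. On `T` the traces agree modulo `ℓ`, which gives (b). If
`𝓛(T)` contains `ℓ ^ k` times all traceless pairs, pairing with `A` under the trace form forces `e ≤
k + 5m`; the ball found above then has radius small enough for (a). -/

namespace PinkSL2

open scoped commutatorElement

attribute [local instance] LieRing.ofAssociativeRing

/-- The `2 × 2` matrices over `ℤ_ℓ`. -/
abbrev Mat (ℓ : ℕ) [Fact ℓ.Prime] := Matrix (Fin 2) (Fin 2) ℤ_[ℓ]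

/-- The group `SL₂(ℤ_ℓ)²`. -/
abbrev SLpair (ℓ : ℕ) [Fact ℓ.Prime] := SL(2, ℤ_[ℓ]) × SL(2, ℤ_[ℓ])

variable {ℓ : ℕ} [Fact ℓ.Prime]

/-! ### Units, divisibility and square roots in `ℤ_ℓ`. -/

section Arithmetic

theorem isUnit_of_dvd_sub {u v : ℤ_[ℓ]} (hv : IsUnit v) (h : (ℓ : ℤ_[ℓ]) ∣ u - v) : IsUnit u := by
  rw [PadicInt.isUnit_iff] at hv ⊢
  by_contra hne
  have hlt : ‖u‖ < 1 := lt_of_le_of_ne (PadicInt.norm_le_one u) hne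
  rw [PadicInt.norm_lt_one_iff_dvd] at hlt
  have : (ℓ : ℤ_[ℓ]) ∣ v := by simpa using dvd_sub hlt h
  rw [← PadicInt.norm_lt_one_iff_dvd] at this
  exact absurd hv this.ne

theorem isUnit_natCast {k : ℕ} (hk : ¬ ℓ ∣ k) : IsUnit (k : ℤ_[ℓ]) := by
  rw [PadicInt.isUnit_iff]
  by_contra hne
  have hlt : ‖(k : ℤ_[ℓ])‖ < 1 := lt_of_le_of_ne (PadicInt.norm_le_one _) hne
  have := (PadicInt.norm_int_lt_one_iff_dvd (p := ℓ) (k : ℤ)).1 (by simpa using hlt)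
  exact hk (by exact_mod_cast this)

theorem isUnit_two (hℓ : 2 < ℓ) : IsUnit (2 : ℤ_[ℓ]) := by
  have := isUnit_natCast (ℓ := ℓ) (k := 2) (fun h => absurd (Nat.le_of_dvd (by norm_num) h) (by omega))
  simpa using this

theorem half_mul_two (hℓ : 2 < ℓ) : Ring.inverse (2 : ℤ_[ℓ]) * 2 = 1 :=
  Ring.inverse_mul_cancel _ (isUnit_two hℓ)

theorem natCast_ne_zero' : (ℓ : ℤ_[ℓ]) ≠ 0 := PadicInt.prime_p.ne_zero

theorem le_of_pow_dvd_pow_mul_unit {a b : ℕ} {u : ℤ_[ℓ]} (hu : IsUnit u)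
    (h : (ℓ : ℤ_[ℓ]) ^ a ∣ (ℓ : ℤ_[ℓ]) ^ b * u) : a ≤ b := by
  rw [hu.dvd_mul_right] at h
  exact (pow_dvd_pow_iff natCast_ne_zero' PadicInt.prime_p.not_isUnit).1 h

theorem pow_dvd_of_pow_dvd_mul {a b : ℕ} (hab : b ≤ a) {x : ℤ_[ℓ]}
    (h : (ℓ : ℤ_[ℓ]) ^ a ∣ (ℓ : ℤ_[ℓ]) ^ b * x) : (ℓ : ℤ_[ℓ]) ^ (a - b) ∣ x := by
  obtain ⟨c, rfl⟩ := Nat.exists_eq_add_of_le hab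
  rw [pow_add] at h
  rw [Nat.add_sub_cancel_left]
  exact (mul_dvd_mul_iff_left (pow_ne_zero _ natCast_ne_zero')).1 h

theorem isUnit_one_add (hℓ : 2 < ℓ) {v : ℤ_[ℓ]} (h : (ℓ : ℤ_[ℓ]) ∣ v - 1) : IsUnit (v + 1) :=
  isUnit_of_dvd_sub (isUnit_two hℓ) (by convert h using 1; ring)

/-- Square roots of elements close to `1`. -/
theorem exists_sq_eq (hℓ : 2 < ℓ) {c : ℕ} (hc : 0 < c) {u : ℤ_[ℓ]}
    (hu : (ℓ : ℤ_[ℓ]) ^ c ∣ u - 1) : ∃ v : ℤ_[ℓ], v ^ 2 = u ∧ (ℓ : ℤ_[ℓ]) ^ c ∣ v - 1 := by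
  have hu1 : (ℓ : ℤ_[ℓ]) ∣ u - 1 := (dvd_pow_self _ hc.ne').trans hu
  have h2 : ‖(2 : ℤ_[ℓ])‖ = 1 := PadicInt.isUnit_iff.1 (isUnit_two hℓ)
  have hd : ‖Polynomial.aeval (1 : ℤ_[ℓ])
      (Polynomial.derivative (Polynomial.X ^ 2 - Polynomial.C u))‖ = 1 := by
    simp only [map_sub, Polynomial.derivative_X_pow, Polynomial.derivative_C, map_mul, map_zero,
      Polynomial.aeval_X, Polynomial.aeval_C, map_pow]
    simpa using h2
  obtain ⟨z, hz, hz1, -, -⟩ := hensels_lemma (p := ℓ) (R := ℤ_[ℓ])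
    (F := Polynomial.X ^ 2 - Polynomial.C u) (a := 1) (by
      rw [hd]
      simp only [map_sub, map_pow, Polynomial.aeval_X, Polynomial.aeval_C, one_pow,
        Algebra.algebraMap_self, RingHom.id_apply]
      rw [norm_sub_rev]
      exact (PadicInt.norm_lt_one_iff_dvd _).2 hu1)
  have hz' : z ^ 2 = u := by simpa [sub_eq_zero] using hz
  have hz1' : (ℓ : ℤ_[ℓ]) ∣ z - 1 := by
    rw [← PadicInt.norm_lt_one_iff_dvd]
    exact hz1.trans_eq hd
  refine ⟨z, hz', ?_⟩
  rw [← (isUnit_one_add hℓ hz1').dvd_mul_right]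
  convert hu using 1
  rw [← hz']; ring

end Arithmetic

/-! ### Congruence subgroups as a basis of neighbourhoods of the identity. -/

section Balls

theorem mem_ball_iff {s : ℕ} {x : SL(2, ℤ_[ℓ])} :
    x ∈ ball ℓ s ↔ ∀ i j, (ℓ : ℤ_[ℓ]) ^ s ∣ x.1 i j - (1 : Mat ℓ) i j := by
  have key : ∀ a b : ℤ_[ℓ], PadicInt.toZModPow s a = PadicInt.toZModPow s b ↔
      (ℓ : ℤ_[ℓ]) ^ s ∣ a - b := by
    intro a b
    rw [← Ideal.mem_span_singleton, ← PadicInt.ker_toZModPow, RingHom.mem_ker, map_sub, sub_eq_zero]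
  rw [ball, MonoidHom.mem_ker, Matrix.SpecialLinearGroup.ext_iff]
  refine forall_congr' fun i => forall_congr' fun j => ?_
  rw [← key]
  simp only [Matrix.SpecialLinearGroup.map_apply_coe, RingHom.mapMatrix_apply, Matrix.map_apply,
    Matrix.SpecialLinearGroup.coe_one]
  by_cases h : i = j <;> simp [h, Matrix.one_apply]

theorem mem_ball_iff_entries {s : ℕ} {x : SL(2, ℤ_[ℓ])} :
    x ∈ ball ℓ s ↔ (ℓ : ℤ_[ℓ]) ^ s ∣ x.1 0 0 - 1 ∧ (ℓ : ℤ_[ℓ]) ^ s ∣ x.1 0 1 ∧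
      (ℓ : ℤ_[ℓ]) ^ s ∣ x.1 1 0 ∧ (ℓ : ℤ_[ℓ]) ^ s ∣ x.1 1 1 - 1 := by
  rw [mem_ball_iff]
  simp [Fin.forall_fin_two, and_assoc]

theorem ball_anti {s t : ℕ} (h : s ≤ t) : ball ℓ t ≤ ball ℓ s := by
  intro x hx
  rw [mem_ball_iff] at hx ⊢
  exact fun i j => (pow_dvd_pow _ h).trans (hx i j)

theorem ball₂_anti {s t : ℕ} (h : s ≤ t) : ball₂ ℓ t t ≤ ball₂ ℓ s s :=
  Subgroup.prod_mono (ball_anti h) (ball_anti h)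

theorem mem_ball₂ {s : ℕ} {x : SLpair ℓ} : x ∈ ball₂ ℓ s s ↔ x.1 ∈ ball ℓ s ∧ x.2 ∈ ball ℓ s :=
  Subgroup.mem_prod

instance ball_normal (s : ℕ) : (ball ℓ s).Normal := MonoidHom.normal_ker _

instance ball₂_normal (s : ℕ) : (ball₂ ℓ s s).Normal := Subgroup.prod_normal _ _

theorem isOpen_ball (s : ℕ) : IsOpen (ball ℓ s : Set SL(2, ℤ_[ℓ])) := by
  have : (ball ℓ s : Set SL(2, ℤ_[ℓ])) = ⋂ i, ⋂ j, {x | x.1 i j - (1 : Mat ℓ) i j ∈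
      {y : ℤ_[ℓ] | ‖y‖ < (ℓ : ℝ) ^ (-(s : ℤ) + 1)}} := by
    ext x
    simp only [SetLike.mem_coe, mem_ball_iff, Set.mem_iInter, Set.mem_ofPred_eq]
    refine forall_congr' fun i => forall_congr' fun j => ?_
    rw [← Ideal.mem_span_singleton, ← PadicInt.norm_le_pow_iff_mem_span_pow,
      PadicInt.norm_le_pow_iff_norm_lt_pow_add_one]
  rw [this]
  refine isOpen_iInter_of_finite fun i => isOpen_iInter_of_finite fun j => ?_
  refine IsOpen.preimage (f := fun x : SL(2, ℤ_[ℓ]) => x.1 i j - (1 : Mat ℓ) i j) ?_ ?_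
  · exact (Continuous.matrix_elem continuous_subtype_val i j).sub continuous_const
  · exact isOpen_lt continuous_norm continuous_const

theorem isOpen_ball₂ (s : ℕ) : IsOpen (ball₂ ℓ s s : Set (SLpair ℓ)) := by
  rw [ball₂, Subgroup.coe_prod]
  exact (isOpen_ball s).prod (isOpen_ball s)

theorem exists_ball_subset {U : Set SL(2, ℤ_[ℓ])} (hU : IsOpen U) (h1 : (1 : SL(2, ℤ_[ℓ])) ∈ U) :
    ∃ s, (ball ℓ s : Set SL(2, ℤ_[ℓ])) ⊆ U := by
  obtain ⟨W, hW, rfl⟩ := isOpen_induced_iff.1 hU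
  have h1' : (1 : Mat ℓ) ∈ W := h1
  obtain ⟨I, u, hu, hsub⟩ := isOpen_pi_iff.1 hW _ h1'
  have : ∀ i, ∃ s : ℕ, ∀ y : Fin 2 → ℤ_[ℓ],
      (∀ j, (ℓ : ℤ_[ℓ]) ^ s ∣ y j - (1 : Mat ℓ) i j) → i ∈ I → y ∈ u i := by
    intro i
    by_cases hi : i ∈ I
    · obtain ⟨J, v, hv, hsub'⟩ := isOpen_pi_iff.1 (hu i hi).1 _ (hu i hi).2
      have : ∀ j, ∃ s : ℕ, ∀ y : ℤ_[ℓ], (ℓ : ℤ_[ℓ]) ^ s ∣ y - (1 : Mat ℓ) i j → j ∈ J → y ∈ v j := by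
        intro j
        by_cases hj : j ∈ J
        · obtain ⟨ε, hε, hball⟩ := Metric.isOpen_iff.1 (hv j hj).1 _ (hv j hj).2
          obtain ⟨s, hs⟩ := PadicInt.exists_pow_neg_lt ℓ hε
          refine ⟨s, fun y hy _ => hball ?_⟩
          rw [mem_ball_iff_norm]
          rw [← Ideal.mem_span_singleton, ← PadicInt.norm_le_pow_iff_mem_span_pow] at hy
          exact hy.trans_lt hs
        · exact ⟨0, fun _ _ h => absurd h hj⟩
      choose s hs using this
      refine ⟨s 0 + s 1, fun y hy _ => hsub' fun j hj => hs j _ ((pow_dvd_pow _ ?_).trans (hy j)) hj⟩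
      fin_cases j <;> simp
    · exact ⟨0, fun _ _ h => absurd h hi⟩
  choose s hs using this
  refine ⟨s 0 + s 1, fun x hx => hsub fun i hi => hs i _ (fun j => (pow_dvd_pow _ ?_).trans
    (mem_ball_iff.1 hx i j)) hi⟩
  fin_cases i <;> simp

theorem exists_ball₂_le {G : Subgroup (SLpair ℓ)} (hG : IsOpen (G : Set (SLpair ℓ))) :
    ∃ s, ball₂ ℓ s s ≤ G := by
  obtain ⟨U, W, hU, hW, h1, h2, hsub⟩ := isOpen_prod_iff.1 hG 1 1 G.one_mem
  obtain ⟨s, hs⟩ := exists_ball_subset hU h1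
  obtain ⟨t, ht⟩ := exists_ball_subset hW h2
  exact ⟨max s t, fun x hx => hsub ⟨hs (ball_anti (le_max_left s t) (mem_ball₂.1 hx).1),
    ht (ball_anti (le_max_right s t) (mem_ball₂.1 hx).2)⟩⟩

end Balls

/-! ### The descending central series and its behaviour under scalars. -/

section LieSeries

/-- The ring `M₂(ℤ_ℓ)²`. -/
abbrev MatPair (ℓ : ℕ) [Fact ℓ.Prime] := Mat ℓ × Mat ℓ

/-- The pairs of matrices of trace zero. -/
noncomputable def slPair (ℓ : ℕ) [Fact ℓ.Prime] : Submodule ℤ_[ℓ] (MatPair ℓ) :=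
  (LinearMap.ker (Matrix.traceLinearMap (Fin 2) ℤ_[ℓ] ℤ_[ℓ])).prod
    (LinearMap.ker (Matrix.traceLinearMap (Fin 2) ℤ_[ℓ] ℤ_[ℓ]))

theorem mem_slPair {X : MatPair ℓ} : X ∈ slPair ℓ ↔ X.1.trace = 0 ∧ X.2.trace = 0 := by
  simp [slPair, Submodule.mem_prod]

/-- The componentwise action of `ℤ_ℓ²` on `M₂(ℤ_ℓ)²`. -/
noncomputable def act (c : ℤ_[ℓ] × ℤ_[ℓ]) : MatPair ℓ →ₗ[ℤ_[ℓ]] MatPair ℓ :=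
  (c.1 • LinearMap.id).prodMap (c.2 • LinearMap.id)

@[simp] theorem act_fst (c : ℤ_[ℓ] × ℤ_[ℓ]) (X : MatPair ℓ) : (act c X).1 = c.1 • X.1 := rfl

@[simp] theorem act_snd (c : ℤ_[ℓ] × ℤ_[ℓ]) (X : MatPair ℓ) : (act c X).2 = c.2 • X.2 := rfl

theorem exists_eq_of_trace_zero {K : Type*} [CommRing K] {X : Matrix (Fin 2) (Fin 2) K}
    (h : X.trace = 0) : ∃ a b c, X = !![a, b; c, -a] := by
  refine ⟨X 0 0, X 0 1, X 1 0, ?_⟩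
  rw [Matrix.trace_fin_two] at h
  rw [Matrix.eta_fin_two X, eq_neg_of_add_eq_zero_right h]
  simp

/-- On traceless matrices `a * b + b * a` is the scalar `tr(ab)`. This is the vector triple product
formula `[a, [c, b]] = 2 tr(ac) b - 2 tr(ab) c`, bracketed with `d`. It trades scalars for deeper
brackets. -/
theorem matrix_swap_identity {K : Type*} [CommRing K] {a b c d : Matrix (Fin 2) (Fin 2) K}
    (ha : a.trace = 0) (hb : b.trace = 0) (hc : c.trace = 0) (hd : d.trace = 0) :
    (2 : K) • ((a * b + b * a) * ⁅c, d⁆ - (a * c + c * a) * ⁅b, d⁆) = -⁅⁅a, ⁅c, b⁆⁆, d⁆ := by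
  obtain ⟨a₁, a₂, a₃, rfl⟩ := exists_eq_of_trace_zero ha
  obtain ⟨b₁, b₂, b₃, rfl⟩ := exists_eq_of_trace_zero hb
  obtain ⟨c₁, c₂, c₃, rfl⟩ := exists_eq_of_trace_zero hc
  obtain ⟨d₁, d₂, d₃, rfl⟩ := exists_eq_of_trace_zero hd
  simp only [Ring.lie_def]
  ext i j
  fin_cases i <;> fin_cases j <;> simp <;> ring

theorem pair_swap_identity {a b c d : MatPair ℓ}
    (ha : a ∈ slPair ℓ) (hb : b ∈ slPair ℓ) (hc : c ∈ slPair ℓ) (hd : d ∈ slPair ℓ) :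
    (2 : ℤ_[ℓ]) • ((a * b + b * a) * ⁅c, d⁆ - (a * c + c * a) * ⁅b, d⁆) = -⁅⁅a, ⁅c, b⁆⁆, d⁆ := by
  rw [mem_slPair] at ha hb hc hd
  exact Prod.ext (matrix_swap_identity ha.1 hb.1 hc.1 hd.1) (matrix_swap_identity ha.2 hb.2 hc.2 hd.2)

theorem trace_lie {K : Type*} [CommRing K] (X Y : Matrix (Fin 2) (Fin 2) K) :
    (⁅X, Y⁆ : Matrix (Fin 2) (Fin 2) K).trace = 0 := by
  rw [Ring.lie_def, Matrix.trace_sub, Matrix.trace_mul_comm, sub_self]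

theorem lie_mem_slPair (X Y : MatPair ℓ) : ⁅X, Y⁆ ∈ slPair ℓ := by
  rw [mem_slPair]
  exact ⟨trace_lie X.1 Y.1, trace_lie X.2 Y.2⟩

/-- The descending central series of `M`: `L₀ = M` and `L_{j+1} = [M, L_j]`. -/
noncomputable def lieSeries (M : Submodule ℤ_[ℓ] (MatPair ℓ)) : ℕ → Submodule ℤ_[ℓ] (MatPair ℓ)
  | 0 => M
  | j + 1 => Submodule.span ℤ_[ℓ] {Z | ∃ X ∈ M, ∃ Y ∈ lieSeries M j, ⁅X, Y⁆ = Z}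

variable {M : Submodule ℤ_[ℓ] (MatPair ℓ)}

theorem lie_mem_lieSeries_succ {j : ℕ} {X Y : MatPair ℓ} (hX : X ∈ M) (hY : Y ∈ lieSeries M j) :
    ⁅X, Y⁆ ∈ lieSeries M (j + 1) :=
  Submodule.subset_span ⟨X, hX, Y, hY, rfl⟩

theorem lieSeries_succ_le (hM : ∀ X ∈ M, ∀ Y ∈ M, ⁅X, Y⁆ ∈ M) (j : ℕ) :
    lieSeries M (j + 1) ≤ lieSeries M j := by
  induction j with
  | zero =>
    refine Submodule.span_le.2 ?_
    rintro _ ⟨X, hX, Y, hY, rfl⟩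
    exact hM X hX Y hY
  | succ j ih =>
    refine Submodule.span_le.2 ?_
    rintro _ ⟨X, hX, Y, hY, rfl⟩
    exact lie_mem_lieSeries_succ hX (ih hY)

theorem lieSeries_antitone (hM : ∀ X ∈ M, ∀ Y ∈ M, ⁅X, Y⁆ ∈ M) : Antitone (lieSeries M) :=
  antitone_nat_of_succ_le (lieSeries_succ_le hM)

theorem lieSeries_le_slPair (hsl : M ≤ slPair ℓ) (j : ℕ) : lieSeries M j ≤ slPair ℓ := by
  cases j with
  | zero => exact hsl
  | succ j =>
    refine Submodule.span_le.2 ?_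
    rintro _ ⟨X, -, Y, -, rfl⟩
    exact lie_mem_slPair X Y

theorem lie_mem_lieSeries (i : ℕ) : ∀ (j : ℕ) {X Y : MatPair ℓ}, X ∈ lieSeries M i →
    Y ∈ lieSeries M j → ⁅X, Y⁆ ∈ lieSeries M (i + j + 1) := by
  induction i with
  | zero =>
    intro j X Y hX hY
    rw [Nat.zero_add]
    exact lie_mem_lieSeries_succ hX hY
  | succ i ih =>
    intro j X Y hX hY
    induction hX using Submodule.span_induction with
    | mem _ h =>
      obtain ⟨U, hU, W, hW, rfl⟩ := h
      rw [lie_lie]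
      refine Submodule.sub_mem _ ?_ ?_
      · convert lie_mem_lieSeries_succ hU (ih j hW hY) using 2; omega
      · convert ih (j + 1) hW (lie_mem_lieSeries_succ hU hY) using 2; omega
    | zero => simp
    | add X X' _ _ h h' => rw [add_lie]; exact Submodule.add_mem _ h h'
    | smul c X _ h => rw [smul_lie]; exact Submodule.smul_mem _ c h

theorem mem_of_two_smul_mem (hℓ : 2 < ℓ) {Λ : Submodule ℤ_[ℓ] (MatPair ℓ)} {X : MatPair ℓ}
    (h : (2 : ℤ_[ℓ]) • X ∈ Λ) : X ∈ Λ := by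
  have := Λ.smul_mem (Ring.inverse (2 : ℤ_[ℓ])) h
  rwa [smul_smul, half_mul_two hℓ, one_smul] at this

/-- The anticommutators of elements of `M`, which are scalars, move the series two steps down. -/
theorem anticommutator_mul_mem_lieSeries (hℓ : 2 < ℓ) (hsl : M ≤ slPair ℓ) {j : ℕ}
    {X Y Z : MatPair ℓ} (hX : X ∈ M) (hY : Y ∈ M) (hZ : Z ∈ lieSeries M (j + 1)) :
    (X * Y + Y * X) * Z ∈ lieSeries M (j + 3) := by
  have swap : ∀ (p q r s : ℕ) (a b c d : MatPair ℓ), a ∈ lieSeries M p → b ∈ lieSeries M q →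
      c ∈ lieSeries M r → d ∈ lieSeries M s → p + q + r + s = j →
      (a * b + b * a) * ⁅c, d⁆ - (a * c + c * a) * ⁅b, d⁆ ∈ lieSeries M (j + 3) := by
    intro p q r s a b c d ha hb hc hd hj
    refine mem_of_two_smul_mem hℓ ?_
    rw [pair_swap_identity (lieSeries_le_slPair hsl _ ha) (lieSeries_le_slPair hsl _ hb)
      (lieSeries_le_slPair hsl _ hc) (lieSeries_le_slPair hsl _ hd)]
    refine Submodule.neg_mem _ ?_
    convert lie_mem_lieSeries _ _ (lie_mem_lieSeries _ _ ha (lie_mem_lieSeries _ _ hc hb)) hd using 2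
    omega
  induction hZ using Submodule.span_induction with
  | mem _ h =>
    -- Each application of `swap` exchanges one entry of the scalar with one of the bracket, modulo
    -- the target. Four exchanges turn `(XY + YX)[U, W]` into its own negative, and 2 is a unit.
    obtain ⟨U, hU, W, hW, rfl⟩ := h
    have h₁ := swap 0 0 0 j X Y U W hX hY hU hW (by omega)
    have h₂ := swap 0 0 j 0 U X W Y hU hX hW hY (by omega)
    have h₃ := swap j 0 0 0 W U X Y hW hU hX hY (by omega)
    have h₄ := swap 0 j 0 0 X W Y U hX hW hY hU (by omega)
    refine mem_of_two_smul_mem hℓ ?_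
    have e : (2 : ℤ_[ℓ]) • ((X * Y + Y * X) * ⁅U, W⁆) =
        ((X * Y + Y * X) * ⁅U, W⁆ - (X * U + U * X) * ⁅Y, W⁆)
        - ((U * X + X * U) * ⁅W, Y⁆ - (U * W + W * U) * ⁅X, Y⁆)
        - ((W * U + U * W) * ⁅X, Y⁆ - (W * X + X * W) * ⁅U, Y⁆)
        + ((X * W + W * X) * ⁅Y, U⁆ - (X * Y + Y * X) * ⁅W, U⁆) := by
      rw [two_smul]
      simp only [Ring.lie_def]
      noncomm_ring
    rw [e]
    exact Submodule.add_mem _ (Submodule.sub_mem _ (Submodule.sub_mem _ h₁ h₂) h₃) h₄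
  | zero => simp
  | add Z Z' _ _ h h' => rw [mul_add]; exact Submodule.add_mem _ h h'
  | smul c Z _ h => rw [mul_smul_comm]; exact Submodule.smul_mem _ c h

/-- The factor `τ + 1` is a pair of units and the modules are stable only under diagonal scalars, so
it cannot be divided out directly. The norm and trace of the pair `τ ^ 2 - 1` are diagonal scalars
and make the division possible. -/
theorem act_sub_one_mem {Λ Λ' : Submodule ℤ_[ℓ] (MatPair ℓ)} (hle : Λ' ≤ Λ) {τ : ℤ_[ℓ] × ℤ_[ℓ]}
    (h₁ : IsUnit (τ.1 + 1)) (h₂ : IsUnit (τ.2 + 1)) (h₃ : IsUnit (τ.1 + τ.2))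
    (h : ∀ Y ∈ Λ, act (τ.1 ^ 2 - 1, τ.2 ^ 2 - 1) Y ∈ Λ') {Y : MatPair ℓ} (hY : Y ∈ Λ) :
    act (τ.1 - 1, τ.2 - 1) Y ∈ Λ' := by
  set c : ℤ_[ℓ] × ℤ_[ℓ] := (τ.1 ^ 2 - 1, τ.2 ^ 2 - 1) with hc
  have hn : (c.1 * c.2) • Y ∈ Λ' := by
    have : (c.1 * c.2) • Y = (c.1 + c.2) • act c Y - act c (act c Y) := by
      ext1 <;> simp only [Prod.smul_fst, Prod.smul_snd, Prod.fst_sub, Prod.snd_sub, act_fst, act_snd]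
        <;> module
    rw [this]
    exact Λ'.sub_mem (Λ'.smul_mem _ (h Y hY)) (h _ (hle (h Y hY)))
  -- With this scalar, `(τᵢ ^ 2 - 1) + (τ₁ - 1)(τ₂ - 1) = (τᵢ - 1)(τ₁ + τ₂)` for both `i`, and `τ₁ +
  -- τ₂` is a unit diagonal scalar.
  have hα : ((τ.1 - 1) * (τ.2 - 1)) • Y ∈ Λ' := by
    obtain ⟨u, hu⟩ := (h₁.mul h₂).exists_left_inv
    have := Λ'.smul_mem u hn
    rw [smul_smul] at this
    convert this using 2
    simp only [hc]
    linear_combination -((τ.1 - 1) * (τ.2 - 1)) * hu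
  obtain ⟨β, hβ⟩ := h₃.exists_left_inv
  have := Λ'.smul_mem β (Λ'.add_mem hα (h Y hY))
  convert this using 1
  ext1 <;> simp only [Prod.smul_fst, Prod.smul_snd, Prod.fst_add, Prod.snd_add, act_fst, act_snd, hc]
  · rw [← add_smul, smul_smul]
    congr 1
    linear_combination -(τ.1 - 1) * hβ
  · rw [← add_smul, smul_smul]
    congr 1
    linear_combination -(τ.2 - 1) * hβ

end LieSeries

/-! ### Algebra of `Θ` and of half-traces. -/

section Theta

/-- Half of the trace of an element of `SL₂(ℤ_ℓ)`. -/
noncomputable def tau (x : SL(2, ℤ_[ℓ])) : ℤ_[ℓ] := Ring.inverse 2 * (x : Mat ℓ).trace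

theorem coe_eq_tau_add_theta (x : SL(2, ℤ_[ℓ])) : (x : Mat ℓ) = tau x • 1 + theta₁ ℓ x := by
  simp [tau, theta₁]

theorem trace_eq_two_mul_tau (hℓ : 2 < ℓ) (x : SL(2, ℤ_[ℓ])) : (x : Mat ℓ).trace = 2 * tau x := by
  rw [tau, ← mul_assoc, mul_comm (2 : ℤ_[ℓ]), half_mul_two hℓ, one_mul]

theorem trace_theta (hℓ : 2 < ℓ) (x : SL(2, ℤ_[ℓ])) : (theta₁ ℓ x).trace = 0 := by
  rw [theta₁, Matrix.trace_sub, Matrix.trace_smul, Matrix.trace_one]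
  simp only [Fintype.card_fin, smul_eq_mul, Nat.cast_ofNat]
  linear_combination -(x : Mat ℓ).trace * half_mul_two hℓ

theorem theta_mem_slPair (hℓ : 2 < ℓ) (x : SLpair ℓ) : theta₂ ℓ x ∈ slPair ℓ :=
  mem_slPair.2 ⟨trace_theta hℓ _, trace_theta hℓ _⟩

theorem det_add_traceless {a b c t : ℤ_[ℓ]} : (t • (1 : Mat ℓ) + !![a, b; c, -a]).det =
    t ^ 2 - a ^ 2 - b * c := by
  simp [Matrix.det_fin_two]; ring

theorem theta_mul_self (hℓ : 2 < ℓ) (x : SL(2, ℤ_[ℓ])) :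
    theta₁ ℓ x * theta₁ ℓ x = (tau x ^ 2 - 1) • 1 := by
  obtain ⟨a, b, c, h⟩ := exists_eq_of_trace_zero (trace_theta hℓ x)
  have hx := x.2
  rw [coe_eq_tau_add_theta, h, det_add_traceless] at hx
  rw [h]
  ext i j
  fin_cases i <;> fin_cases j <;> simp
  · linear_combination -hx
  · ring
  · ring
  · linear_combination -hx

theorem coe_inv_eq (hℓ : 2 < ℓ) (x : SL(2, ℤ_[ℓ])) : ((x⁻¹ : SL(2, ℤ_[ℓ])) : Mat ℓ) =
    tau x • 1 - theta₁ ℓ x := by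
  obtain ⟨a, b, c, h⟩ := exists_eq_of_trace_zero (trace_theta hℓ x)
  rw [Matrix.SpecialLinearGroup.coe_inv, coe_eq_tau_add_theta, h, Matrix.adjugate_fin_two]
  ext i j
  fin_cases i <;> fin_cases j <;> simp [sub_eq_add_neg]

theorem tau_inv (x : SL(2, ℤ_[ℓ])) : tau x⁻¹ = tau x := by
  rw [tau, tau, Matrix.SpecialLinearGroup.coe_inv, Matrix.trace_fin_two, Matrix.trace_fin_two,
    Matrix.adjugate_fin_two]
  simp [add_comm]

theorem theta_inv (hℓ : 2 < ℓ) (x : SL(2, ℤ_[ℓ])) : theta₁ ℓ x⁻¹ = -theta₁ ℓ x := by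
  have h := coe_eq_tau_add_theta x⁻¹
  rw [coe_inv_eq hℓ, tau_inv] at h
  rw [sub_eq_add_neg] at h
  exact (add_left_cancel h).symm

theorem half_trace_mul {K : Type*} [CommRing K] {h : K} (hh : h * 2 = 1)
    {X Y : Matrix (Fin 2) (Fin 2) K} (hX : X.trace = 0) (hY : Y.trace = 0) :
    X * Y - (h * (X * Y).trace) • 1 = h • ⁅X, Y⁆ := by
  obtain ⟨a, b, c, rfl⟩ := exists_eq_of_trace_zero hX
  obtain ⟨d, e, f, rfl⟩ := exists_eq_of_trace_zero hY
  simp only [Ring.lie_def]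
  ext i j
  fin_cases i <;> fin_cases j <;>
    simp [Matrix.trace_fin_two]
  · linear_combination -(a * d + b * f) * hh
  · linear_combination -(a * e - b * d) * hh
  · linear_combination -(c * d - a * f) * hh
  · linear_combination -(c * e + a * d) * hh

theorem theta_of_coe_eq (hℓ : 2 < ℓ) {x : SL(2, ℤ_[ℓ])} {s : ℤ_[ℓ]} {X : Mat ℓ}
    (hX : X.trace = 0) (h : (x : Mat ℓ) = s • 1 + X) : theta₁ ℓ x = X := by
  rw [theta₁, h, Matrix.trace_add, hX, Matrix.trace_smul, Matrix.trace_one]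
  simp only [Fintype.card_fin, smul_eq_mul, Nat.cast_ofNat, add_zero]
  have : Ring.inverse 2 * (s * 2) = s := by linear_combination s * half_mul_two hℓ
  rw [this, add_sub_cancel_left]

theorem theta_mul (hℓ : 2 < ℓ) (x y : SL(2, ℤ_[ℓ])) : theta₁ ℓ (x * y) =
    tau x • theta₁ ℓ y + tau y • theta₁ ℓ x + Ring.inverse (2 : ℤ_[ℓ]) • ⁅theta₁ ℓ x, theta₁ ℓ y⁆ := by
  have hXY := half_trace_mul (half_mul_two hℓ) (trace_theta hℓ x) (trace_theta hℓ y)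
  refine theta_of_coe_eq hℓ (s := tau x * tau y +
    Ring.inverse (2 : ℤ_[ℓ]) * (theta₁ ℓ x * theta₁ ℓ y).trace) ?_ ?_
  · simp [Matrix.trace_add, trace_theta hℓ]
  · rw [← hXY, Matrix.SpecialLinearGroup.coe_mul, coe_eq_tau_add_theta x, coe_eq_tau_add_theta y]
    simp only [add_mul, mul_add, smul_mul_assoc, mul_smul_comm, one_mul, mul_one]
    module

theorem theta_mul_sub (hℓ : 2 < ℓ) (x y : SL(2, ℤ_[ℓ])) :
    theta₁ ℓ (x * y) - theta₁ ℓ (y * x) = ⁅theta₁ ℓ x, theta₁ ℓ y⁆ := by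
  rw [theta_mul hℓ, theta_mul hℓ, ← lie_skew (theta₁ ℓ y)]
  have h := half_mul_two hℓ
  calc _ = (Ring.inverse (2 : ℤ_[ℓ]) * 2) • ⁅theta₁ ℓ x, theta₁ ℓ y⁆ := by module
    _ = _ := by rw [h, one_smul]

/-- `Θ` of a commutator is, to first order, the Lie bracket of the `Θ`s. -/
theorem theta_commutator (hℓ : 2 < ℓ) (x y : SL(2, ℤ_[ℓ])) :
    theta₁ ℓ ⁅x, y⁆ = tau (y * x) • ⁅theta₁ ℓ x, theta₁ ℓ y⁆ -
      Ring.inverse (2 : ℤ_[ℓ]) • ⁅⁅theta₁ ℓ x, theta₁ ℓ y⁆, theta₁ ℓ (y * x)⁆ := by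
  have htr : (⁅theta₁ ℓ x, theta₁ ℓ y⁆ : Mat ℓ).trace = 0 := trace_lie _ _
  have hXY := half_trace_mul (half_mul_two hℓ) htr (trace_theta hℓ (y * x))
  have hc : (⁅x, y⁆ : SL(2, ℤ_[ℓ])) = x * y * (y * x)⁻¹ := by
    rw [commutatorElement_def]; group
  -- The traces of `xy` and `yx` agree, so these matrices differ only in their traceless parts.
  have hxy : ((x * y : SL(2, ℤ_[ℓ])) : Mat ℓ) = (y * x : SL(2, ℤ_[ℓ])) + ⁅theta₁ ℓ x, theta₁ ℓ y⁆ := by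
    rw [← theta_mul_sub hℓ, coe_eq_tau_add_theta (x * y), coe_eq_tau_add_theta (y * x)]
    have : tau (x * y) = tau (y * x) := by
      rw [tau, tau, Matrix.SpecialLinearGroup.coe_mul, Matrix.SpecialLinearGroup.coe_mul,
        Matrix.trace_mul_comm]
    rw [this]; abel
  have hcoe : ((⁅x, y⁆ : SL(2, ℤ_[ℓ])) : Mat ℓ) = 1 + ⁅theta₁ ℓ x, theta₁ ℓ y⁆ *
      (tau (y * x) • 1 - theta₁ ℓ (y * x)) := by
    rw [hc, Matrix.SpecialLinearGroup.coe_mul, hxy, add_mul, ← coe_inv_eq hℓ,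
      ← Matrix.SpecialLinearGroup.coe_mul, mul_inv_cancel, Matrix.SpecialLinearGroup.coe_one]
  refine theta_of_coe_eq hℓ (s := 1 - Ring.inverse (2 : ℤ_[ℓ]) *
    (⁅theta₁ ℓ x, theta₁ ℓ y⁆ * theta₁ ℓ (y * x)).trace) ?_ ?_
  · simp [Matrix.trace_sub]
  · rw [hcoe, ← hXY, mul_sub, mul_smul_comm, mul_one]
    module

theorem tau_sub_one_mem (hℓ : 2 < ℓ) {s : ℕ} {x : SL(2, ℤ_[ℓ])} (hx : x ∈ ball ℓ s) :
    (ℓ : ℤ_[ℓ]) ^ s ∣ tau x - 1 := by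
  rw [mem_ball_iff_entries] at hx
  have : tau x - 1 = Ring.inverse 2 * ((x.1 0 0 - 1) + (x.1 1 1 - 1)) := by
    rw [tau, Matrix.trace_fin_two]
    linear_combination half_mul_two hℓ
  rw [this]
  exact (dvd_add hx.1 hx.2.2.2).mul_left _

theorem theta_mem_of_mem_ball (hℓ : 2 < ℓ) {s : ℕ} {x : SL(2, ℤ_[ℓ])} (hx : x ∈ ball ℓ s) (i j) :
    (ℓ : ℤ_[ℓ]) ^ s ∣ theta₁ ℓ x i j := by
  have h1 := mem_ball_iff.1 hx i j
  have h2 := tau_sub_one_mem hℓ hx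
  have : theta₁ ℓ x i j = (x.1 i j - (1 : Mat ℓ) i j) - (tau x - 1) * (1 : Mat ℓ) i j := by
    rw [theta₁, Matrix.sub_apply, Matrix.smul_apply, smul_eq_mul]
    simp only [tau]; ring
  rw [this]
  exact dvd_sub h1 (h2.mul_right _)

/-- The determinant condition gives `Θ ^ 2 = (τ - 1)(τ + 1)`, and `hx` makes `τ + 1` a unit. It
excludes `x = -1`, whose `Θ` vanishes. -/
theorem mem_ball_of_theta (hℓ : 2 < ℓ) {s : ℕ} {x : SL(2, ℤ_[ℓ])} (hx : x ∈ ball ℓ 1)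
    (h : ∀ i j, (ℓ : ℤ_[ℓ]) ^ s ∣ theta₁ ℓ x i j) : x ∈ ball ℓ s := by
  have ht : (ℓ : ℤ_[ℓ]) ^ s ∣ tau x - 1 := by
    have h1 : (ℓ : ℤ_[ℓ]) ∣ tau x - 1 := by simpa using tau_sub_one_mem hℓ hx
    rw [← (isUnit_one_add hℓ h1).dvd_mul_right]
    have e := congrFun (congrFun (theta_mul_self hℓ x) 0) 0
    simp only [Matrix.mul_apply, Fin.sum_univ_two, Matrix.smul_apply, Matrix.one_apply_eq,
      smul_eq_mul, mul_one] at e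
    have : (tau x - 1) * (tau x + 1) = tau x ^ 2 - 1 := by ring
    rw [this, ← e]
    exact dvd_add ((h 0 0).mul_right _) ((h 0 1).mul_right _)
  rw [mem_ball_iff]
  intro i j
  have : x.1 i j - (1 : Mat ℓ) i j = theta₁ ℓ x i j + (tau x - 1) * (1 : Mat ℓ) i j := by
    rw [theta₁, Matrix.sub_apply, Matrix.smul_apply, smul_eq_mul]
    simp only [tau]; ring
  rw [this]
  exact dvd_add (h i j) (ht.mul_right _)

end Theta

/-! ### Pink's theorem: recovering group elements from `[𝓛, 𝓛]`. -/

section Approximation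

/-- Half of the traces of the two components. -/
noncomputable def tau₂ (x : SLpair ℓ) : ℤ_[ℓ] × ℤ_[ℓ] := (tau x.1, tau x.2)

theorem theta₂_mul (hℓ : 2 < ℓ) (x y : SLpair ℓ) : theta₂ ℓ (x * y) =
    act (tau₂ x) (theta₂ ℓ y) + act (tau₂ y) (theta₂ ℓ x) +
      Ring.inverse (2 : ℤ_[ℓ]) • ⁅theta₂ ℓ x, theta₂ ℓ y⁆ :=
  Prod.ext (theta_mul hℓ x.1 y.1) (theta_mul hℓ x.2 y.2)

theorem theta₂_inv (hℓ : 2 < ℓ) (x : SLpair ℓ) : theta₂ ℓ x⁻¹ = -theta₂ ℓ x :=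
  Prod.ext (theta_inv hℓ x.1) (theta_inv hℓ x.2)

theorem theta₂_one (hℓ : 2 < ℓ) : theta₂ ℓ 1 = 0 :=
  Prod.ext (theta_of_coe_eq hℓ (s := 1) (Matrix.trace_zero _ _) (by simp))
    (theta_of_coe_eq hℓ (s := 1) (Matrix.trace_zero _ _) (by simp))

theorem theta₂_mul_sub (hℓ : 2 < ℓ) (x y : SLpair ℓ) :
    theta₂ ℓ (x * y) - theta₂ ℓ (y * x) = ⁅theta₂ ℓ x, theta₂ ℓ y⁆ :=
  Prod.ext (theta_mul_sub hℓ x.1 y.1) (theta_mul_sub hℓ x.2 y.2)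

theorem theta₂_commutator (hℓ : 2 < ℓ) (x y : SLpair ℓ) :
    theta₂ ℓ ⁅x, y⁆ = act (tau₂ (y * x)) ⁅theta₂ ℓ x, theta₂ ℓ y⁆ -
      Ring.inverse (2 : ℤ_[ℓ]) • ⁅⁅theta₂ ℓ x, theta₂ ℓ y⁆, theta₂ ℓ (y * x)⁆ :=
  Prod.ext (theta_commutator hℓ x.1 y.1) (theta_commutator hℓ x.2 y.2)

theorem act_tau_eq (x : SLpair ℓ) (Y : MatPair ℓ) :
    act (tau₂ x) Y = Y + act ((tau₂ x).1 - 1, (tau₂ x).2 - 1) Y := by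
  ext1 <;> simp only [act_fst, act_snd, Prod.fst_add, Prod.snd_add] <;> module

variable {Γ : Subgroup (SLpair ℓ)}

theorem theta₂_mem_lieAlg {x : SLpair ℓ} (hx : x ∈ Γ) : theta₂ ℓ x ∈ lieAlg ℓ Γ :=
  Submodule.subset_span ⟨x, hx, rfl⟩

theorem lieAlg_le_slPair (hℓ : 2 < ℓ) : lieAlg ℓ Γ ≤ slPair ℓ := by
  refine Submodule.span_le.2 ?_
  rintro _ ⟨x, -, rfl⟩
  exact theta_mem_slPair hℓ x

theorem lie_mem_lieAlg (hℓ : 2 < ℓ) (X : MatPair ℓ) (hX : X ∈ lieAlg ℓ Γ) (Y : MatPair ℓ)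
    (hY : Y ∈ lieAlg ℓ Γ) : ⁅X, Y⁆ ∈ lieAlg ℓ Γ := by
  induction hX using Submodule.span_induction with
  | zero => simp
  | add X X' _ _ h h' => rw [add_lie]; exact Submodule.add_mem _ h h'
  | smul c X _ h => rw [smul_lie]; exact Submodule.smul_mem _ c h
  | mem _ h =>
    obtain ⟨x, hx, rfl⟩ := h
    induction hY using Submodule.span_induction with
    | zero => simp
    | add X X' _ _ h h' => rw [lie_add]; exact Submodule.add_mem _ h h'
    | smul c X _ h => rw [lie_smul]; exact Submodule.smul_mem _ c h
    | mem _ h =>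
      obtain ⟨y, hy, rfl⟩ := h
      rw [← theta₂_mul_sub hℓ]
      exact Submodule.sub_mem _ (theta₂_mem_lieAlg (Γ.mul_mem hx hy))
        (theta₂_mem_lieAlg (Γ.mul_mem hy hx))

theorem lieSeries_lieAlg_antitone (hℓ : 2 < ℓ) : Antitone (lieSeries (lieAlg ℓ Γ)) :=
  lieSeries_antitone (lie_mem_lieAlg hℓ)

theorem act_tau_sub_one_mem (hℓ : 2 < ℓ) {x : SLpair ℓ} (hx : x ∈ ball₂ ℓ 1 1)
    (hxM : theta₂ ℓ x ∈ lieAlg ℓ Γ) {j : ℕ} {Y : MatPair ℓ}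
    (hY : Y ∈ lieSeries (lieAlg ℓ Γ) (j + 1)) :
    act ((tau₂ x).1 - 1, (tau₂ x).2 - 1) Y ∈ lieSeries (lieAlg ℓ Γ) (j + 3) := by
  have h₁ : (ℓ : ℤ_[ℓ]) ∣ tau x.1 - 1 := by simpa using tau_sub_one_mem hℓ (mem_ball₂.1 hx).1
  have h₂ : (ℓ : ℤ_[ℓ]) ∣ tau x.2 - 1 := by simpa using tau_sub_one_mem hℓ (mem_ball₂.1 hx).2
  refine act_sub_one_mem (lieSeries_lieAlg_antitone hℓ (by omega : j + 1 ≤ j + 3))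
    (isUnit_one_add hℓ h₁) (isUnit_one_add hℓ h₂) ?_ ?_ hY
  · refine isUnit_of_dvd_sub (isUnit_two hℓ) ?_
    convert dvd_add h₁ h₂ using 1
    simp only [tau₂]; ring
  · intro Y hY
    have h := anticommutator_mul_mem_lieSeries hℓ (lieAlg_le_slPair hℓ) hxM hxM hY
    refine mem_of_two_smul_mem hℓ ?_
    convert h using 1
    ext1
    · simp only [Prod.smul_fst, act_fst, Prod.fst_mul, Prod.fst_add, theta₂, theta_mul_self hℓ]
      rw [← add_smul, smul_mul_assoc, one_mul, smul_smul, two_mul]; rfl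
    · simp only [Prod.smul_snd, act_snd, Prod.snd_mul, Prod.snd_add, theta₂, theta_mul_self hℓ]
      rw [← add_smul, smul_mul_assoc, one_mul, smul_smul, two_mul]; rfl

/-- `Θ` is additive modulo the next step of the series. -/
theorem theta₂_mul_sub_add_mem (hℓ : 2 < ℓ) {x y : SLpair ℓ} (hx : x ∈ ball₂ ℓ 1 1)
    (hy : y ∈ ball₂ ℓ 1 1) {j : ℕ} (hxj : theta₂ ℓ x ∈ lieSeries (lieAlg ℓ Γ) (j + 1))
    (hyj : theta₂ ℓ y ∈ lieSeries (lieAlg ℓ Γ) (j + 1)) :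
    theta₂ ℓ (x * y) - (theta₂ ℓ x + theta₂ ℓ y) ∈ lieSeries (lieAlg ℓ Γ) (j + 2) := by
  have anti := lieSeries_lieAlg_antitone (Γ := Γ) hℓ
  have h₁ := act_tau_sub_one_mem hℓ hx (anti (Nat.zero_le _) hxj) hyj
  have h₂ := act_tau_sub_one_mem hℓ hy (anti (Nat.zero_le _) hyj) hxj
  have h₃ := lie_mem_lieSeries _ _ hxj hyj
  have e : theta₂ ℓ (x * y) - (theta₂ ℓ x + theta₂ ℓ y) =
      act ((tau₂ x).1 - 1, (tau₂ x).2 - 1) (theta₂ ℓ y) +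
      act ((tau₂ y).1 - 1, (tau₂ y).2 - 1) (theta₂ ℓ x) +
      Ring.inverse (2 : ℤ_[ℓ]) • ⁅theta₂ ℓ x, theta₂ ℓ y⁆ := by
    rw [theta₂_mul hℓ, act_tau_eq, act_tau_eq]; abel
  rw [e]
  exact Submodule.add_mem _ (Submodule.add_mem _ (anti (by omega) h₁) (anti (by omega) h₂))
    (Submodule.smul_mem _ _ (anti (by omega) h₃))

theorem theta₂_commutator_sub_mem (hℓ : 2 < ℓ) (hΓ : Γ ≤ ball₂ ℓ 1 1) {x y : SLpair ℓ} (hx : x ∈ Γ)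
    (hy : y ∈ Γ) {j : ℕ} (hyj : theta₂ ℓ y ∈ lieSeries (lieAlg ℓ Γ) j) :
    theta₂ ℓ ⁅x, y⁆ - ⁅theta₂ ℓ x, theta₂ ℓ y⁆ ∈ lieSeries (lieAlg ℓ Γ) (j + 2) := by
  have anti := lieSeries_lieAlg_antitone (Γ := Γ) hℓ
  have hyx := theta₂_mem_lieAlg (Γ.mul_mem hy hx)
  have hb := lie_mem_lieSeries_succ (theta₂_mem_lieAlg hx) hyj
  have h₁ := act_tau_sub_one_mem hℓ (hΓ (Γ.mul_mem hy hx)) hyx hb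
  have h₂ := lie_mem_lieSeries _ 0 hb hyx
  have e : theta₂ ℓ ⁅x, y⁆ - ⁅theta₂ ℓ x, theta₂ ℓ y⁆ =
      act ((tau₂ (y * x)).1 - 1, (tau₂ (y * x)).2 - 1) ⁅theta₂ ℓ x, theta₂ ℓ y⁆ -
      Ring.inverse (2 : ℤ_[ℓ]) • ⁅⁅theta₂ ℓ x, theta₂ ℓ y⁆, theta₂ ℓ (y * x)⁆ := by
    rw [theta₂_commutator hℓ, act_tau_eq]; abel
  rw [e]
  exact Submodule.sub_mem _ (anti (by omega) h₁) (Submodule.smul_mem _ _ h₂)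

/-- The half-trace of the preimage must be a square root of `1 - det X`, and a root close to 1
exists because `X` is small. -/
theorem exists_theta_eq (hℓ : 2 < ℓ) {s : ℕ} (hs : 0 < s) {X : Mat ℓ} (hX : X.trace = 0)
    (hd : ∀ i j, (ℓ : ℤ_[ℓ]) ^ s ∣ X i j) : ∃ x ∈ ball ℓ s, theta₁ ℓ x = X := by
  obtain ⟨a, b, c, rfl⟩ := exists_eq_of_trace_zero hX
  have ha : (ℓ : ℤ_[ℓ]) ^ s ∣ a := by simpa using hd 0 0
  have hb : (ℓ : ℤ_[ℓ]) ^ s ∣ b := by simpa using hd 0 1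
  have hc : (ℓ : ℤ_[ℓ]) ^ s ∣ c := by simpa using hd 1 0
  obtain ⟨t, ht, ht1⟩ := exists_sq_eq hℓ hs (u := 1 + a ^ 2 + b * c) (by
    have : (1 + a ^ 2 + b * c - 1 : ℤ_[ℓ]) = a * a + b * c := by ring
    rw [this]
    exact dvd_add (ha.mul_right _) (hb.mul_right _))
  have hdet : (t • (1 : Mat ℓ) + !![a, b; c, -a]).det = 1 := by
    rw [det_add_traceless, ht]; ring
  obtain ⟨x, hx⟩ : ∃ x : SL(2, ℤ_[ℓ]), x.1 = t • (1 : Mat ℓ) + !![a, b; c, -a] := ⟨⟨_, hdet⟩, rfl⟩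
  refine ⟨x, ?_, theta_of_coe_eq hℓ hX hx⟩
  rw [mem_ball_iff_entries, hx]
  refine ⟨?_, by simpa using hb, by simpa using hc, ?_⟩
  · convert dvd_add ht1 ha using 1; simp; ring
  · convert dvd_sub ht1 ha using 1; simp; ring

theorem exists_lie_add_lie_eq (hℓ : 2 < ℓ) {Z : Mat ℓ} (hZ : Z.trace = 0) :
    ∃ X Y X' Y' : Mat ℓ, X.trace = 0 ∧ Y.trace = 0 ∧ X'.trace = 0 ∧ Y'.trace = 0 ∧
      Z = ⁅X, Y⁆ + ⁅X', Y'⁆ := by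
  obtain ⟨a, b, c, rfl⟩ := exists_eq_of_trace_zero hZ
  have h := half_mul_two hℓ
  set v := Ring.inverse (2 : ℤ_[ℓ])
  -- In the standard basis: `[aE, F] = aH` and `[H/2, bE - cF] = bE + cF`.
  refine ⟨!![0, a; 0, 0], !![0, 0; 1, 0], !![v, 0; 0, -v], !![0, b; -c, 0],
    ?_, ?_, ?_, ?_, ?_⟩
  any_goals simp [Matrix.trace_fin_two]
  simp only [Ring.lie_def]
  ext i j
  fin_cases i <;> fin_cases j <;> simp
  · linear_combination -b * h
  · linear_combination -c * h

/-- Openness of every term of the series. It lets natural numbers stand in for `ℓ`-adic scalars in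
`exists_approximation_submodule`. -/
theorem exists_pow_smul_mem_lieSeries (hℓ : 2 < ℓ) {s : ℕ} (hs : ball₂ ℓ s s ≤ Γ) (j : ℕ) :
    ∃ t : ℕ, ∀ X ∈ slPair ℓ, ((ℓ : ℤ_[ℓ]) ^ t) • X ∈ lieSeries (lieAlg ℓ Γ) j := by
  have base : ∀ X ∈ slPair ℓ, ((ℓ : ℤ_[ℓ]) ^ (s + 1)) • X ∈ lieAlg ℓ Γ := by
    intro X hX
    rw [mem_slPair] at hX
    obtain ⟨x, hx, hxX⟩ := exists_theta_eq hℓ (Nat.succ_pos s) (X := ((ℓ : ℤ_[ℓ]) ^ (s + 1)) • X.1)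
      (by simp [hX.1]) (fun i j => by simp)
    obtain ⟨y, hy, hyX⟩ := exists_theta_eq hℓ (Nat.succ_pos s) (X := ((ℓ : ℤ_[ℓ]) ^ (s + 1)) • X.2)
      (by simp [hX.2]) (fun i j => by simp)
    have : ((ℓ : ℤ_[ℓ]) ^ (s + 1)) • X = theta₂ ℓ (x, y) := Prod.ext hxX.symm hyX.symm
    rw [this]
    exact theta₂_mem_lieAlg (hs (ball₂_anti (Nat.le_succ s) (mem_ball₂.2 ⟨hx, hy⟩)))
  induction j with
  | zero => exact ⟨s + 1, base⟩
  | succ j ih =>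
    obtain ⟨t, ht⟩ := ih
    refine ⟨s + 1 + t, fun Z hZ => ?_⟩
    rw [mem_slPair] at hZ
    obtain ⟨X₁, Y₁, U₁, W₁, hX₁, hY₁, hU₁, hW₁, e₁⟩ := exists_lie_add_lie_eq hℓ hZ.1
    obtain ⟨X₂, Y₂, U₂, W₂, hX₂, hY₂, hU₂, hW₂, e₂⟩ := exists_lie_add_lie_eq hℓ hZ.2
    have e : ((ℓ : ℤ_[ℓ]) ^ (s + 1 + t)) • Z =
        ⁅((ℓ : ℤ_[ℓ]) ^ (s + 1)) • ((X₁, X₂) : MatPair ℓ), ((ℓ : ℤ_[ℓ]) ^ t) • ((Y₁, Y₂) : MatPair ℓ)⁆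
        + ⁅((ℓ : ℤ_[ℓ]) ^ (s + 1)) • ((U₁, U₂) : MatPair ℓ),
          ((ℓ : ℤ_[ℓ]) ^ t) • ((W₁, W₂) : MatPair ℓ)⁆ := by
      have eZ : Z = ⁅((X₁, X₂) : MatPair ℓ), ((Y₁, Y₂) : MatPair ℓ)⁆
          + ⁅((U₁, U₂) : MatPair ℓ), ((W₁, W₂) : MatPair ℓ)⁆ := Prod.ext e₁ e₂
      rw [eZ, smul_lie, smul_lie, lie_smul, lie_smul, smul_smul, smul_smul, ← pow_add, smul_add]
    rw [e]
    exact Submodule.add_mem _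
      (lie_mem_lieSeries_succ (base _ (mem_slPair.2 ⟨hX₁, hX₂⟩)) (ht _ (mem_slPair.2 ⟨hY₁, hY₂⟩)))
      (lie_mem_lieSeries_succ (base _ (mem_slPair.2 ⟨hU₁, hU₂⟩)) (ht _ (mem_slPair.2 ⟨hW₁, hW₂⟩)))

theorem exists_natCast_sub_dvd (t : ℕ) (c : ℤ_[ℓ]) : ∃ k : ℕ, (ℓ : ℤ_[ℓ]) ^ t ∣ c - k :=
  ⟨c.appr t, Ideal.mem_span_singleton.1 (PadicInt.appr_spec t c)⟩

/-- Linearity of being approximable by `Θ(Γ)` modulo the next term: sums come from products in `Γ`,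
since `Θ` is additive modulo that term. Surjectivity on graded pieces thus need only be checked on
brackets. -/
theorem exists_approximation_submodule (hℓ : 2 < ℓ) (hΓ : Γ ≤ ball₂ ℓ 1 1) {s : ℕ}
    (hs : ball₂ ℓ s s ≤ Γ) (j : ℕ) : ∃ S : Submodule ℤ_[ℓ] (MatPair ℓ), ∀ X, X ∈ S ↔
      X ∈ lieSeries (lieAlg ℓ Γ) (j + 1) ∧
        ∃ γ ∈ Γ, theta₂ ℓ γ - X ∈ lieSeries (lieAlg ℓ Γ) (j + 2) := by
  have anti := lieSeries_lieAlg_antitone (Γ := Γ) hℓ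
  have hadd : ∀ X Y : MatPair ℓ, (X ∈ lieSeries (lieAlg ℓ Γ) (j + 1) ∧
        ∃ γ ∈ Γ, theta₂ ℓ γ - X ∈ lieSeries (lieAlg ℓ Γ) (j + 2)) →
      (Y ∈ lieSeries (lieAlg ℓ Γ) (j + 1) ∧
        ∃ γ ∈ Γ, theta₂ ℓ γ - Y ∈ lieSeries (lieAlg ℓ Γ) (j + 2)) →
      (X + Y ∈ lieSeries (lieAlg ℓ Γ) (j + 1) ∧
        ∃ γ ∈ Γ, theta₂ ℓ γ - (X + Y) ∈ lieSeries (lieAlg ℓ Γ) (j + 2)) := by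
    rintro X Y ⟨hX, γ, hγ, hγX⟩ ⟨hY, δ, hδ, hδY⟩
    refine ⟨Submodule.add_mem _ hX hY, γ * δ, Γ.mul_mem hγ hδ, ?_⟩
    have h₁ : theta₂ ℓ γ ∈ lieSeries (lieAlg ℓ Γ) (j + 1) := by
      have := Submodule.add_mem _ (anti (Nat.le_succ _) hγX) hX
      rwa [sub_add_cancel] at this
    have h₂ : theta₂ ℓ δ ∈ lieSeries (lieAlg ℓ Γ) (j + 1) := by
      have := Submodule.add_mem _ (anti (Nat.le_succ _) hδY) hY
      rwa [sub_add_cancel] at this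
    have h₃ := theta₂_mul_sub_add_mem hℓ (hΓ hγ) (hΓ hδ) h₁ h₂
    convert Submodule.add_mem _ h₃ (Submodule.add_mem _ hγX hδY) using 1
    abel
  have hzero : ((0 : MatPair ℓ) ∈ lieSeries (lieAlg ℓ Γ) (j + 1) ∧
        ∃ γ ∈ Γ, theta₂ ℓ γ - 0 ∈ lieSeries (lieAlg ℓ Γ) (j + 2)) :=
    ⟨Submodule.zero_mem _, 1, Γ.one_mem, by simp [theta₂_one hℓ]⟩
  refine ⟨⟨⟨⟨{X | X ∈ lieSeries (lieAlg ℓ Γ) (j + 1) ∧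
        ∃ γ ∈ Γ, theta₂ ℓ γ - X ∈ lieSeries (lieAlg ℓ Γ) (j + 2)}, fun {X Y} => hadd X Y⟩,
        hzero⟩, ?_⟩, fun X => Iff.rfl⟩
  rintro c X hX
  obtain ⟨t, ht⟩ := exists_pow_smul_mem_lieSeries hℓ hs (Γ := Γ) (j + 2)
  obtain ⟨k, d, hd⟩ := exists_natCast_sub_dvd t c
  have hc : c • X = k • X + ((ℓ : ℤ_[ℓ]) ^ t) • (d • X) := by
    rw [smul_smul, ← hd, ← Nat.cast_smul_eq_nsmul ℤ_[ℓ], ← add_smul]; congr 1; ring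
  have hsmall : ((ℓ : ℤ_[ℓ]) ^ t) • (d • X) ∈ lieSeries (lieAlg ℓ Γ) (j + 2) :=
    ht _ (Submodule.smul_mem _ _ (lieSeries_le_slPair (lieAlg_le_slPair hℓ) _ hX.1))
  change c • X ∈ lieSeries (lieAlg ℓ Γ) (j + 1) ∧
        ∃ γ ∈ Γ, theta₂ ℓ γ - c • X ∈ lieSeries (lieAlg ℓ Γ) (j + 2)
  rw [hc]
  refine hadd _ _ ?_ ⟨anti (Nat.le_succ _) hsmall, 1, Γ.one_mem, ?_⟩
  · clear hd hc
    induction k with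
    | zero => rw [zero_smul]; exact hzero
    | succ k ih => rw [succ_nsmul]; exact hadd _ _ ih hX
  · rw [theta₂_one hℓ, zero_sub]
    exact Submodule.neg_mem _ hsmall

/-- Brackets are approximated by group commutators, using an approximant of the inner argument from
the preceding degree. -/
theorem exists_theta₂_sub_mem (hℓ : 2 < ℓ) (hΓ : Γ ≤ ball₂ ℓ 1 1) {s : ℕ}
    (hs : ball₂ ℓ s s ≤ Γ) (j : ℕ) : ∀ X ∈ lieSeries (lieAlg ℓ Γ) (j + 1),
      ∃ γ ∈ Γ, theta₂ ℓ γ - X ∈ lieSeries (lieAlg ℓ Γ) (j + 2) := by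
  have anti := lieSeries_lieAlg_antitone (Γ := Γ) hℓ
  have hcomm : ∀ (j : ℕ) (x y : SLpair ℓ), x ∈ Γ → y ∈ Γ → ∀ W, W ∈ lieSeries (lieAlg ℓ Γ) j →
      theta₂ ℓ y ∈ lieSeries (lieAlg ℓ Γ) j → theta₂ ℓ y - W ∈ lieSeries (lieAlg ℓ Γ) (j + 1) →
      ⁅theta₂ ℓ x, W⁆ ∈ lieSeries (lieAlg ℓ Γ) (j + 1) ∧
      ∃ γ ∈ Γ, theta₂ ℓ γ - ⁅theta₂ ℓ x, W⁆ ∈ lieSeries (lieAlg ℓ Γ) (j + 2) := by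
    intro j x y hx hy W hW hyj hyW
    refine ⟨lie_mem_lieSeries_succ (theta₂_mem_lieAlg hx) hW, ⁅x, y⁆,
      Γ.mul_mem (Γ.mul_mem (Γ.mul_mem hx hy) (Γ.inv_mem hx)) (Γ.inv_mem hy), ?_⟩
    have h₁ := theta₂_commutator_sub_mem hℓ hΓ hx hy hyj
    have h₂ := lie_mem_lieSeries_succ (theta₂_mem_lieAlg hx) hyW
    rw [lie_sub] at h₂
    convert Submodule.add_mem _ h₁ h₂ using 1
    abel
  induction j with
  | zero =>
    obtain ⟨S, hS⟩ := exists_approximation_submodule hℓ hΓ hs 0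
    suffices h : lieSeries (lieAlg ℓ Γ) 1 ≤ S from fun X hX => ((hS X).1 (h hX)).2
    refine Submodule.span_le.2 ?_
    rintro _ ⟨U, hU, W, hW, rfl⟩
    change W ∈ lieAlg ℓ Γ at hW
    change ⁅U, W⁆ ∈ S
    induction hU using Submodule.span_induction with
    | zero => simp
    | add X X' _ _ h h' => rw [add_lie]; exact Submodule.add_mem _ h h'
    | smul c X _ h => rw [smul_lie]; exact Submodule.smul_mem _ c h
    | mem _ h =>
      obtain ⟨x, hx, rfl⟩ := h
      induction hW using Submodule.span_induction with
      | zero => simp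
      | add X X' _ _ h h' => rw [lie_add]; exact Submodule.add_mem _ h h'
      | smul c X _ h => rw [lie_smul]; exact Submodule.smul_mem _ c h
      | mem _ h =>
        obtain ⟨y, hy, rfl⟩ := h
        refine (hS _).2 (hcomm 0 x y hx hy _ (theta₂_mem_lieAlg hy) (theta₂_mem_lieAlg hy) ?_)
        rw [sub_self]
        exact Submodule.zero_mem _
  | succ j ih =>
    obtain ⟨S, hS⟩ := exists_approximation_submodule hℓ hΓ hs (j + 1)
    suffices h : lieSeries (lieAlg ℓ Γ) (j + 2) ≤ S from fun X hX => ((hS X).1 (h hX)).2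
    refine Submodule.span_le.2 ?_
    rintro _ ⟨U, hU, W, hW, rfl⟩
    change ⁅U, W⁆ ∈ S
    obtain ⟨y, hy, hyW⟩ := ih W hW
    have hyj : theta₂ ℓ y ∈ lieSeries (lieAlg ℓ Γ) (j + 1) := by
      have := Submodule.add_mem _ (anti (Nat.le_succ _) hyW) hW
      rwa [sub_add_cancel] at this
    induction hU using Submodule.span_induction with
    | zero => simp
    | add X X' _ _ h h' => rw [add_lie]; exact Submodule.add_mem _ h h'
    | smul c X _ h => rw [smul_lie]; exact Submodule.smul_mem _ c h
    | mem _ h =>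
      obtain ⟨x, hx, rfl⟩ := h
      exact (hS _).2 (hcomm (j + 1) x y hx hy W hW hyj hyW)

theorem lieSeries_dvd (hℓ : 2 < ℓ) (hΓ : Γ ≤ ball₂ ℓ 1 1) (j : ℕ) {X : MatPair ℓ}
    (hX : X ∈ lieSeries (lieAlg ℓ Γ) j) :
    ∃ Y : MatPair ℓ, X = ((ℓ : ℤ_[ℓ]) ^ j) • Y := by
  induction j generalizing X with
  | zero => exact ⟨X, by simp⟩
  | succ j ih =>
    induction hX using Submodule.span_induction with
    | zero => exact ⟨0, by simp⟩
    | add X X' _ _ h h' =>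
      obtain ⟨Y, rfl⟩ := h
      obtain ⟨Y', rfl⟩ := h'
      exact ⟨Y + Y', by rw [smul_add]⟩
    | smul c X _ h =>
      obtain ⟨Y, rfl⟩ := h
      exact ⟨c • Y, by rw [smul_comm]⟩
    | mem _ h =>
      obtain ⟨U, hU, W, hW, rfl⟩ := h
      obtain ⟨W, rfl⟩ := ih hW
      have : ∃ Y : MatPair ℓ, U = (ℓ : ℤ_[ℓ]) • Y := by
        clear hW
        induction hU using Submodule.span_induction with
        | zero => exact ⟨0, by simp⟩
        | add X X' _ _ h h' =>
          obtain ⟨Y, rfl⟩ := h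
          obtain ⟨Y', rfl⟩ := h'
          exact ⟨Y + Y', by rw [smul_add]⟩
        | smul c X _ h =>
          obtain ⟨Y, rfl⟩ := h
          exact ⟨c • Y, by rw [smul_comm]⟩
        | mem _ h =>
          obtain ⟨x, hx, rfl⟩ := h
          have h₁ := theta_mem_of_mem_ball hℓ (mem_ball₂.1 (hΓ hx)).1
          have h₂ := theta_mem_of_mem_ball hℓ (mem_ball₂.1 (hΓ hx)).2
          simp only [pow_one] at h₁ h₂
          choose Y hY using h₁
          choose Y' hY' using h₂
          exact ⟨(Matrix.of Y, Matrix.of Y'), Prod.ext (Matrix.ext hY) (Matrix.ext hY')⟩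
      obtain ⟨Y, rfl⟩ := this
      exact ⟨⁅Y, W⁆, by rw [pow_succ', smul_lie, lie_smul, smul_smul]⟩

/-- An open subgroup of `𝓑_ℓ(1, 1)` contains every element whose `Θ` lies in `[𝓛, 𝓛]`. -/
theorem mem_of_theta₂_mem (hℓ : 2 < ℓ) (hΓ : Γ ≤ ball₂ ℓ 1 1) {s : ℕ}
    (hs : ball₂ ℓ s s ≤ Γ) {h : SLpair ℓ} (hh : h ∈ ball₂ ℓ 1 1)
    (hθ : theta₂ ℓ h ∈ lieSeries (lieAlg ℓ Γ) 1) : h ∈ Γ := by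
  have anti := lieSeries_lieAlg_antitone (Γ := Γ) hℓ
  -- Successive approximation: left multiplication by `Γ` pushes `h` down the series. The terms
  -- shrink `ℓ`-adically, so `γ * h` eventually enters the ball inside `Γ`.
  have step : ∀ j : ℕ, ∃ γ ∈ Γ, theta₂ ℓ (γ * h) ∈ lieSeries (lieAlg ℓ Γ) (j + 1) := by
    intro j
    induction j with
    | zero => exact ⟨1, Γ.one_mem, by rwa [one_mul]⟩
    | succ j ih =>
      obtain ⟨γ, hγ, hγh⟩ := ih
      obtain ⟨δ, hδ, hδh⟩ := exists_theta₂_sub_mem hℓ hΓ hs j _ hγh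
      refine ⟨δ⁻¹ * γ, Γ.mul_mem (Γ.inv_mem hδ) hγ, ?_⟩
      have hδj : theta₂ ℓ δ⁻¹ ∈ lieSeries (lieAlg ℓ Γ) (j + 1) := by
        have := Submodule.add_mem _ (anti (Nat.le_succ _) hδh) hγh
        rw [sub_add_cancel] at this
        rw [theta₂_inv hℓ]
        exact Submodule.neg_mem _ this
      have h₁ := theta₂_mul_sub_add_mem hℓ (Subgroup.inv_mem _ (hΓ hδ))
        (Subgroup.mul_mem _ (hΓ hγ) hh) hδj hγh
      rw [mul_assoc]
      convert Submodule.sub_mem _ h₁ hδh using 1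
      rw [theta₂_inv hℓ]
      abel
  obtain ⟨γ, hγ, hγh⟩ := step s
  obtain ⟨Y, hY⟩ := lieSeries_dvd hℓ hΓ _ hγh
  have hb := Subgroup.mul_mem _ (hΓ hγ) hh
  have hmem : γ * h ∈ ball₂ ℓ s s := by
    refine ball₂_anti (Nat.le_succ s) (mem_ball₂.2 ⟨mem_ball_of_theta hℓ (mem_ball₂.1 hb).1 ?_,
      mem_ball_of_theta hℓ (mem_ball₂.1 hb).2 ?_⟩)
    · intro i j
      have : theta₁ ℓ (γ * h).1 = ((ℓ : ℤ_[ℓ]) ^ (s + 1)) • Y.1 := congrArg Prod.fst hY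
      rw [this]; simp
    · intro i j
      have : theta₁ ℓ (γ * h).2 = ((ℓ : ℤ_[ℓ]) ^ (s + 1)) • Y.2 := congrArg Prod.snd hY
      rw [this]; simp
  exact (Subgroup.mul_mem_cancel_left _ hγ).1 (hs hmem)

end Approximation

/-! ### Balls generated by commutators with elementary matrices. -/

section Commutators

theorem commutatorElement_eq_of_mul_eq {P : Type*} [Group P] {h t x : P}
    (e : h * t = x * (t * h)) : ⁅h, t⁆ = x := by
  rw [commutatorElement_def, e]; group

theorem exists_coe_eq {K : Type*} [CommRing K] {A : Matrix (Fin 2) (Fin 2) K} (h : A.det = 1) :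
    ∃ g : SL(2, K), g.1 = A := ⟨⟨A, h⟩, rfl⟩

/-- If `H` contains the image of `𝓑_ℓ(a)` in one factor and its projection to this factor contains
the elementary matrices with entry `ℓ ^ m` (up to a unit), then the commutator subgroup of `H`
contains the image of `𝓑_ℓ(a + m)`. -/
theorem ball_le_comap_commutator (hℓ : 2 < ℓ) {P : Type*} [Group P] {H : Subgroup P}
    (ι : SL(2, ℤ_[ℓ]) →* P) (p : P →* SL(2, ℤ_[ℓ])) (hι : ∀ h t, ⁅ι h, t⁆ = ι ⁅h, p t⁆)
    {a m : ℕ} (ha : 0 < a) (haH : ball ℓ a ≤ H.comap ι) {u : ℤ_[ℓ]} (hu : IsUnit u)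
    (hU : ∃ t ∈ H, (p t).1 = !![1, (ℓ : ℤ_[ℓ]) ^ m * u; 0, 1])
    (hL : ∃ t ∈ H, (p t).1 = !![1, 0; (ℓ : ℤ_[ℓ]) ^ m * u, 1]) :
    ball ℓ (a + m) ≤ ⁅H, H⁆.comap ι := by
  have mem : ∀ {h x : SL(2, ℤ_[ℓ])} {t : P}, h ∈ ball ℓ a → t ∈ H → h * p t = x * (p t * h) →
      x ∈ ⁅H, H⁆.comap ι := by
    intro h x t hh ht e
    rw [Subgroup.mem_comap, ← commutatorElement_eq_of_mul_eq e, ← hι]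
    exact Subgroup.commutator_mem_commutator (haH hh) ht
  obtain ⟨v, hv⟩ := hu.exists_right_inv
  obtain ⟨tU, htU, hpU⟩ := hU
  obtain ⟨tL, htL, hpL⟩ := hL
  have divide : ∀ x : ℤ_[ℓ], (ℓ : ℤ_[ℓ]) ^ (a + m) ∣ x →
      ∃ w, (ℓ : ℤ_[ℓ]) ^ a ∣ w ∧ w * ((ℓ : ℤ_[ℓ]) ^ m * u) = x := by
    rintro x ⟨c, rfl⟩
    refine ⟨(ℓ : ℤ_[ℓ]) ^ a * (c * v), dvd_mul_right _ _, ?_⟩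
    rw [pow_add]
    linear_combination (ℓ : ℤ_[ℓ]) ^ a * (ℓ : ℤ_[ℓ]) ^ m * c * hv
  have diag : ∀ w : ℤ_[ℓ], (ℓ : ℤ_[ℓ]) ^ a ∣ w → ∃ d d' : ℤ_[ℓ], d * d' = 1 ∧ d ^ 2 = 1 + w ∧
      (ℓ : ℤ_[ℓ]) ^ a ∣ d - 1 ∧ (ℓ : ℤ_[ℓ]) ^ a ∣ d' - 1 := by
    intro w hw
    obtain ⟨d, hd, hd1⟩ := exists_sq_eq hℓ ha (u := 1 + w) (by simpa using hw)
    obtain ⟨d', hd'⟩ := (isUnit_of_dvd_sub isUnit_one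
      ((dvd_pow_self _ ha.ne').trans hd1)).exists_right_inv
    refine ⟨d, d', hd', hd, hd1, ?_⟩
    have : d' - 1 = -(d - 1) * d' := by linear_combination hd'
    rw [this]
    exact (hd1.neg_right).mul_right _
  -- The commutator of `diag(d, d⁻¹)` with the elementary matrix of entry `y` is elementary with
  -- entry `(d ^ 2 - 1) y`.
  have upper : ∀ {x : ℤ_[ℓ]} {g : SL(2, ℤ_[ℓ])}, (ℓ : ℤ_[ℓ]) ^ (a + m) ∣ x →
      g.1 = !![1, x; 0, 1] → g ∈ ⁅H, H⁆.comap ι := by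
    intro x g hx hg
    obtain ⟨w, hw, e⟩ := divide x hx
    obtain ⟨d, d', hdd, hd2, hd, hd'⟩ := diag w hw
    obtain ⟨D, hD⟩ := exists_coe_eq (A := !![d, 0; 0, d']) (by simp [Matrix.det_fin_two, hdd])
    refine mem (h := D) (t := tU) ?_ htU ?_
    · rw [mem_ball_iff_entries, hD]
      simp [hd, hd']
    · apply Subtype.ext
      simp only [Matrix.SpecialLinearGroup.coe_mul, hg]
      rw [hD, hpU]
      ext i j
      fin_cases i <;> fin_cases j <;> simp
      linear_combination d' * e + d' * ((ℓ : ℤ_[ℓ]) ^ m * u) * hd2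
        - d * ((ℓ : ℤ_[ℓ]) ^ m * u) * hdd
  have lower : ∀ {x : ℤ_[ℓ]} {g : SL(2, ℤ_[ℓ])}, (ℓ : ℤ_[ℓ]) ^ (a + m) ∣ x →
      g.1 = !![1, 0; x, 1] → g ∈ ⁅H, H⁆.comap ι := by
    intro x g hx hg
    obtain ⟨w, hw, e⟩ := divide x hx
    obtain ⟨d, d', hdd, hd2, hd, hd'⟩ := diag w hw
    obtain ⟨D, hD⟩ := exists_coe_eq (A := !![d', 0; 0, d])
      (by simp [Matrix.det_fin_two]; linear_combination hdd)
    refine mem (h := D) (t := tL) ?_ htL ?_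
    · rw [mem_ball_iff_entries, hD]
      simp [hd, hd']
    · apply Subtype.ext
      simp only [Matrix.SpecialLinearGroup.coe_mul, hg]
      rw [hD, hpL]
      ext i j
      fin_cases i <;> fin_cases j <;> simp
      linear_combination d' * e + d' * ((ℓ : ℤ_[ℓ]) ^ m * u) * hd2
        - d * ((ℓ : ℤ_[ℓ]) ^ m * u) * hdd
  intro g hg
  rw [mem_ball_iff_entries] at hg
  obtain ⟨hg₁, hg₂, hg₃, -⟩ := hg
  have hdet := g.2
  rw [Matrix.det_fin_two] at hdet
  have hc : 0 < a + m := by omega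
  -- The commutator `k` of an upper and a lower elementary matrix with entries `x`, `y` has corner
  -- entry `1 + z + z ^ 2`, where `z = xy`. Matching it with that of `g` leaves only elementary
  -- factors on both sides. The quadratic is solved through `(1 + 2z) ^ 2 = 1 + 4 (g₀₀ - 1)`.
  obtain ⟨z, hz, hzp⟩ : ∃ z : ℤ_[ℓ], (ℓ : ℤ_[ℓ]) ^ (a + m) ∣ z ∧ 1 + z + z ^ 2 = g.1 0 0 := by
    obtain ⟨r, hr, hr1⟩ := exists_sq_eq hℓ hc (u := 1 + 4 * (g.1 0 0 - 1))
      (by simpa using hg₁.mul_left 4)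
    obtain ⟨c, hc⟩ := hr1
    have h2 := half_mul_two hℓ
    refine ⟨Ring.inverse 2 * (r - 1), hc ▸ (dvd_mul_right _ _).mul_left _, ?_⟩
    set b := Ring.inverse (2 : ℤ_[ℓ])
    linear_combination b ^ 2 * hr + ((g.1 0 0 - 1) * (2 * b + 1) - b * (r - 1)) * h2
  obtain ⟨x, hx, hxz⟩ := divide z hz
  set y := (ℓ : ℤ_[ℓ]) ^ m * u with hy
  obtain ⟨X, hX⟩ := exists_coe_eq (A := !![1, x; 0, 1]) (by simp [Matrix.det_fin_two])
  obtain ⟨k, hk⟩ := exists_coe_eq (A := !![1 + z + z ^ 2, -(x * z); z * y, 1 - z])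
    (by simp only [Matrix.det_fin_two_of]; linear_combination z ^ 2 * hxz)
  have hkm : k ∈ ⁅H, H⁆.comap ι := by
    refine mem (h := X) (t := tL) ?_ htL ?_
    · rw [mem_ball_iff_entries, hX]
      simp [hx]
    · apply Subtype.ext
      simp only [Matrix.SpecialLinearGroup.coe_mul]
      rw [hX, hpL, hk]
      ext i j
      fin_cases i <;> fin_cases j <;> simp
      · linear_combination (1 + z) * hxz
      · linear_combination x * z * hxz
      · ring
      · linear_combination -hxz
  have hp1 : IsUnit (g.1 0 0) := isUnit_of_dvd_sub isUnit_one ((dvd_pow_self _ hc.ne').trans hg₁)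
  obtain ⟨q, hq⟩ := hp1.exists_right_inv
  obtain ⟨A, hA⟩ := exists_coe_eq (A := !![1, 0; (g.1 1 0 - z * y) * q, 1])
    (by simp [Matrix.det_fin_two])
  obtain ⟨B, hB⟩ := exists_coe_eq (A := !![1, (g.1 0 1 + x * z) * q; 0, 1])
    (by simp [Matrix.det_fin_two])
  have hgk : g = A * k * B := by
    have hcoe : (A * k * B).1 = !![1, 0; (g.1 1 0 - z * y) * q, 1] *
        !![1 + z + z ^ 2, -(x * z); z * y, 1 - z] * !![1, (g.1 0 1 + x * z) * q; 0, 1] := by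
      rw [← hA, ← hB, ← hk]; rfl
    have h00 : (A * k * B).1 0 0 = g.1 0 0 := by
      rw [hcoe]; simp [hzp]
    have h01 : (A * k * B).1 0 1 = g.1 0 1 := by
      rw [hcoe, hzp]; simp
      linear_combination (g.1 0 1 + x * z) * hq
    have h10 : (A * k * B).1 1 0 = g.1 1 0 := by
      rw [hcoe, hzp]; simp
      linear_combination (g.1 1 0 - z * y) * hq
    have hdet' := (A * k * B).2
    rw [Matrix.det_fin_two, h00, h01, h10] at hdet'
    have h11 : (A * k * B).1 1 1 = g.1 1 1 :=
      hp1.mul_left_cancel (by linear_combination hdet' - hdet)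
    apply Subtype.ext
    rw [Matrix.eta_fin_two g.1, Matrix.eta_fin_two (A * k * B).1, h00, h01, h10, h11]
  rw [hgk]
  refine Subgroup.mul_mem _ (Subgroup.mul_mem _ (lower ?_ hA) hkm) (upper ?_ hB)
  · exact (dvd_sub hg₃ (hz.mul_right _)).mul_right _
  · exact (dvd_add hg₂ (hz.mul_left _)).mul_right _

theorem ball₂_le_commutator (hℓ : 2 < ℓ) {H : Subgroup (SLpair ℓ)} {a m : ℕ} (ha : 0 < a)
    (haH : ball₂ ℓ a a ≤ H) {u : ℤ_[ℓ]} (hu : IsUnit u)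
    (hU₁ : ∃ t ∈ H, t.1.1 = !![1, (ℓ : ℤ_[ℓ]) ^ m * u; 0, 1])
    (hL₁ : ∃ t ∈ H, t.1.1 = !![1, 0; (ℓ : ℤ_[ℓ]) ^ m * u, 1])
    (hU₂ : ∃ t ∈ H, t.2.1 = !![1, (ℓ : ℤ_[ℓ]) ^ m * u; 0, 1])
    (hL₂ : ∃ t ∈ H, t.2.1 = !![1, 0; (ℓ : ℤ_[ℓ]) ^ m * u, 1]) :
    ball₂ ℓ (a + m) (a + m) ≤ ⁅H, H⁆ := by
  rintro ⟨g₁, g₂⟩ hg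
  rw [mem_ball₂] at hg
  have h₁ := ball_le_comap_commutator hℓ (MonoidHom.inl _ _) (MonoidHom.fst _ _)
    (fun h t => by simp [commutatorElement_def, Prod.ext_iff])
    ha (fun x hx => haH (mem_ball₂.2 ⟨hx, Subgroup.one_mem _⟩)) hu hU₁ hL₁ hg.1
  have h₂ := ball_le_comap_commutator hℓ (MonoidHom.inr _ _) (MonoidHom.snd _ _)
    (fun h t => by simp [commutatorElement_def, Prod.ext_iff])
    ha (fun x hx => haH (mem_ball₂.2 ⟨Subgroup.one_mem _, hx⟩)) hu hU₂ hL₂ hg.2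
  have := Subgroup.mul_mem _ (Subgroup.mem_comap.1 h₁) (Subgroup.mem_comap.1 h₂)
  simpa using this

end Commutators

/-! ### Lifting unipotents from a projection into the congruence kernel. -/

section Lifts

theorem mem_ball_one_iff {x : SL(2, ℤ_[ℓ])} : x ∈ ball ℓ 1 ↔ red ℓ x = 1 := by
  have key : ∀ a b : ℤ_[ℓ], PadicInt.toZMod a = PadicInt.toZMod b ↔ (ℓ : ℤ_[ℓ]) ^ 1 ∣ a - b := by
    intro a b
    rw [pow_one, ← Ideal.mem_span_singleton, ← PadicInt.maximalIdeal_eq_span_p,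
      ← PadicInt.ker_toZMod, RingHom.mem_ker, map_sub, sub_eq_zero]
  rw [mem_ball_iff, red, Matrix.SpecialLinearGroup.ext_iff]
  refine forall_congr' fun i => forall_congr' fun j => ?_
  rw [← key]
  simp only [Matrix.SpecialLinearGroup.map_apply_coe, RingHom.mapMatrix_apply, Matrix.map_apply,
    Matrix.SpecialLinearGroup.coe_one]
  by_cases h : i = j <;> simp [h, Matrix.one_apply]

/-- The exponent is the order of `GL₂(𝔽_ℓ)`. Only one factor `ℓ` in it is a non-unit, so passing to
the congruence kernel costs a single power of `ℓ`. -/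
theorem pow_mem_ball_one (x : SL(2, ℤ_[ℓ])) : x ^ (ℓ * ((ℓ ^ 2 - 1) * (ℓ - 1))) ∈ ball ℓ 1 := by
  rw [mem_ball_one_iff, map_pow]
  have hcard : Nat.card (GL (Fin 2) (ZMod ℓ)) = ℓ * ((ℓ ^ 2 - 1) * (ℓ - 1)) := by
    rw [Matrix.card_GL_field, Fin.prod_univ_two, ZMod.card]
    have : ℓ ^ 2 - ℓ ^ 1 = ℓ * (ℓ - 1) := by rw [Nat.mul_sub, mul_one, pow_one, pow_two]
    simp only [Fin.val_zero, Fin.val_one, pow_zero, this]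
    ring
  have hinj : Function.Injective (Matrix.SpecialLinearGroup.toGL (n := Fin 2) (R := ZMod ℓ)) := by
    intro a b hab
    apply Subtype.ext
    exact congrArg Units.val hab
  apply hinj
  rw [map_pow, map_one, ← hcard]
  exact pow_card_eq_one'

theorem not_dvd_card_factor (hℓ : 2 < ℓ) : ¬ ℓ ∣ (ℓ ^ 2 - 1) * (ℓ - 1) := by
  have hp : ℓ.Prime := Fact.out
  rw [hp.dvd_mul]
  rintro (h | h)
  · have h1 : ℓ ∣ ℓ ^ 2 := dvd_pow_self _ two_ne_zero
    have := (Nat.dvd_sub_iff_right (Nat.one_le_pow _ _ hp.pos) h1).1 h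
    exact hp.one_lt.ne' (Nat.dvd_one.1 this)
  · exact absurd (Nat.le_of_dvd (by omega) h) (by omega)

theorem coe_pow_of_nilpotent {K : Type*} [CommRing K] {V : Matrix (Fin 2) (Fin 2) K} (hV : V * V = 0)
    {g : SL(2, K)} {x : K} (hg : g.1 = 1 + x • V) (k : ℕ) :
    (g ^ k).1 = 1 + (k * x) • V := by
  induction k with
  | zero => simp
  | succ k ih =>
    rw [pow_succ]
    change (g ^ k).1 * g.1 = _
    rw [ih, hg, add_mul, mul_add, mul_add, smul_mul_smul_comm, hV]
    simp only [mul_one, one_mul, smul_zero, add_zero, Nat.cast_add, Nat.cast_one]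
    module

theorem mul_self_of_trace_det_zero {K : Type*} [CommRing K] {V : Matrix (Fin 2) (Fin 2) K}
    (ht : V.trace = 0) (hd : V.det = 0) : V * V = 0 := by
  obtain ⟨a, b, c, rfl⟩ := exists_eq_of_trace_zero ht
  rw [Matrix.det_fin_two_of] at hd
  ext i j
  fin_cases i <;> fin_cases j <;> simp
  · linear_combination -hd
  · ring
  · ring
  · linear_combination -hd

theorem det_one_add_smul {K : Type*} [CommRing K] {V : Matrix (Fin 2) (Fin 2) K}
    (ht : V.trace = 0) (hd : V.det = 0) (x : K) : (1 + x • V).det = 1 := by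
  obtain ⟨a, b, c, rfl⟩ := exists_eq_of_trace_zero ht
  rw [Matrix.det_fin_two_of] at hd
  simp [Matrix.det_fin_two]
  linear_combination x ^ 2 * hd

theorem exists_mem_coe_eq {G : Subgroup (SLpair ℓ)} {p : SLpair ℓ →* SL(2, ℤ_[ℓ])} {n : ℕ}
    (hG : ball ℓ n ≤ G.map p) {V : Mat ℓ} (ht : V.trace = 0) (hd : V.det = 0) :
    ∃ t ∈ G, (p t).1 = 1 + ((ℓ : ℤ_[ℓ]) ^ n) • V := by
  obtain ⟨g, hg⟩ := exists_coe_eq (det_one_add_smul ht hd ((ℓ : ℤ_[ℓ]) ^ n))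
  have hgn : g ∈ ball ℓ n := by
    rw [mem_ball_iff, hg]
    intro i j
    simp
  obtain ⟨t, ht, rfl⟩ := hG hgn
  exact ⟨t, ht, hg⟩

/-- Lifts of unipotent elements of the projections to the congruence kernel of `G`. -/
theorem exists_mem_inf_ball_coe_eq {G : Subgroup (SLpair ℓ)} {p : SLpair ℓ →* SL(2, ℤ_[ℓ])} {n : ℕ}
    (hG : ball ℓ n ≤ G.map p) {V : Mat ℓ} (ht : V.trace = 0) (hd : V.det = 0) :
    ∃ z ∈ G ⊓ ball₂ ℓ 1 1, (p z).1 =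
      1 + ((ℓ : ℤ_[ℓ]) ^ (n + 1) * (((ℓ ^ 2 - 1) * (ℓ - 1) : ℕ) : ℤ_[ℓ])) • V := by
  obtain ⟨t, htG, ht'⟩ := exists_mem_coe_eq hG ht hd
  refine ⟨t ^ (ℓ * ((ℓ ^ 2 - 1) * (ℓ - 1))), ⟨G.pow_mem htG _, mem_ball₂.2
    ⟨pow_mem_ball_one t.1, pow_mem_ball_one t.2⟩⟩, ?_⟩
  rw [map_pow, coe_pow_of_nilpotent (mul_self_of_trace_det_zero ht hd) ht', Nat.cast_mul ℓ]
  congr 2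
  ring

end Lifts

/-! ### A ball inside the group, from one element with distinct traces. -/

section Openness

variable {Γ : Subgroup (SLpair ℓ)}

theorem act_tau_mem_lieAlg (hℓ : 2 < ℓ) {x : SLpair ℓ} (hx : x ∈ Γ) {X : MatPair ℓ}
    (hX : X ∈ lieAlg ℓ Γ) : act (tau₂ x) X ∈ lieAlg ℓ Γ := by
  induction hX using Submodule.span_induction with
  | zero => simp
  | add X X' _ _ h h' => rw [map_add]; exact Submodule.add_mem _ h h'
  | smul c X _ h => rw [map_smul]; exact Submodule.smul_mem _ c h
  | mem _ h =>
    obtain ⟨z, hz, rfl⟩ := h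
    refine mem_of_two_smul_mem hℓ ?_
    have e : (2 : ℤ_[ℓ]) • act (tau₂ x) (theta₂ ℓ z) = theta₂ ℓ (x * z) + theta₂ ℓ (x⁻¹ * z) := by
      have ht : tau₂ x⁻¹ = tau₂ x := Prod.ext (tau_inv x.1) (tau_inv x.2)
      rw [theta₂_mul hℓ, theta₂_mul hℓ, theta₂_inv hℓ, ht, map_neg, neg_lie]
      module
    rw [e]
    exact Submodule.add_mem _ (theta₂_mem_lieAlg (Γ.mul_mem hx hz))
      (theta₂_mem_lieAlg (Γ.mul_mem (Γ.inv_mem hx) hz))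

theorem ball₂_le_of_tau_sub (hℓ : 2 < ℓ) (hΓ : Γ ≤ ball₂ ℓ 1 1) {s : ℕ} (hs : ball₂ ℓ s s ≤ Γ)
    {m e : ℕ} (hm : 0 < m)
    (h₁ : ∀ Y : Mat ℓ, Y.trace = 0 → ∃ Z ∈ lieAlg ℓ Γ, Z.1 = ((ℓ : ℤ_[ℓ]) ^ m) • Y)
    (h₂ : ∀ Y : Mat ℓ, Y.trace = 0 → ∃ Z ∈ lieAlg ℓ Γ, Z.2 = ((ℓ : ℤ_[ℓ]) ^ m) • Y)
    {x : SLpair ℓ} (hx : x ∈ Γ) {u : ℤ_[ℓ]} (hu : IsUnit u)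
    (he : tau x.1 - tau x.2 = (ℓ : ℤ_[ℓ]) ^ e * u) :
    ball₂ ℓ (e + 2 * m) (e + 2 * m) ≤ Γ := by
  obtain ⟨v, hv⟩ := hu.exists_left_inv
  -- Acting by `τ(x) - τ(x.2)` kills the second component and multiplies the first by `ℓ ^ e u`.
  have hM₁ : ∀ Y : Mat ℓ, Y.trace = 0 → (((ℓ : ℤ_[ℓ]) ^ (e + m)) • Y, (0 : Mat ℓ)) ∈ lieAlg ℓ Γ := by
    intro Y hY
    obtain ⟨Z, hZ, hZY⟩ := h₁ Y hY
    have := Submodule.smul_mem _ v (Submodule.sub_mem _ (act_tau_mem_lieAlg hℓ hx hZ)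
      (Submodule.smul_mem _ (tau x.2) hZ))
    convert this using 1
    ext1
    · simp only [Prod.smul_fst, Prod.fst_sub, act_fst, tau₂]
      rw [← sub_smul, he, hZY, smul_smul, smul_smul, pow_add]
      congr 1
      linear_combination -(ℓ : ℤ_[ℓ]) ^ e * (ℓ : ℤ_[ℓ]) ^ m * hv
    · simp [tau₂]
  have hM₂ : ∀ Y : Mat ℓ, Y.trace = 0 → ((0 : Mat ℓ), ((ℓ : ℤ_[ℓ]) ^ (e + m)) • Y) ∈ lieAlg ℓ Γ := by
    intro Y hY
    obtain ⟨Z, hZ, hZY⟩ := h₂ Y hY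
    have := Submodule.smul_mem _ v (Submodule.sub_mem _
      (Submodule.smul_mem _ (tau x.1) hZ) (act_tau_mem_lieAlg hℓ hx hZ))
    convert this using 1
    ext1
    · simp [tau₂]
    · simp only [Prod.smul_snd, Prod.snd_sub, act_snd, tau₂]
      rw [← sub_smul, he, hZY, smul_smul, smul_smul, pow_add]
      congr 1
      linear_combination -(ℓ : ℤ_[ℓ]) ^ e * (ℓ : ℤ_[ℓ]) ^ m * hv
  have lie₁ : ∀ X Y : Mat ℓ, X.trace = 0 → Y.trace = 0 →
      (((ℓ : ℤ_[ℓ]) ^ (e + 2 * m)) • ⁅X, Y⁆, (0 : Mat ℓ)) ∈ lieSeries (lieAlg ℓ Γ) 1 := by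
    intro X Y hX hY
    obtain ⟨Z, hZ, hZY⟩ := h₁ Y hY
    convert lie_mem_lieSeries_succ (j := 0) (hM₁ X hX) hZ using 1
    ext1
    · change _ = ⁅((ℓ : ℤ_[ℓ]) ^ (e + m)) • X, Z.1⁆
      rw [hZY, smul_lie, lie_smul, smul_smul, ← pow_add,
        show e + m + m = e + 2 * m by ring]
    · change _ = ⁅(0 : Mat ℓ), Z.2⁆
      rw [zero_lie]
  have lie₂ : ∀ X Y : Mat ℓ, X.trace = 0 → Y.trace = 0 →
      ((0 : Mat ℓ), ((ℓ : ℤ_[ℓ]) ^ (e + 2 * m)) • ⁅X, Y⁆) ∈ lieSeries (lieAlg ℓ Γ) 1 := by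
    intro X Y hX hY
    obtain ⟨Z, hZ, hZY⟩ := h₂ Y hY
    convert lie_mem_lieSeries_succ (j := 0) (hM₂ X hX) hZ using 1
    ext1
    · change _ = ⁅(0 : Mat ℓ), Z.1⁆
      rw [zero_lie]
    · change _ = ⁅((ℓ : ℤ_[ℓ]) ^ (e + m)) • X, Z.2⁆
      rw [hZY, smul_lie, lie_smul, smul_smul, ← pow_add,
        show e + m + m = e + 2 * m by ring]
  intro h hh
  refine mem_of_theta₂_mem hℓ hΓ hs (ball₂_anti (by omega) hh) ?_
  have main : ∀ g ∈ ball ℓ (e + 2 * m), ∃ X Y X' Y' : Mat ℓ, X.trace = 0 ∧ Y.trace = 0 ∧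
      X'.trace = 0 ∧ Y'.trace = 0 ∧
      theta₁ ℓ g = ((ℓ : ℤ_[ℓ]) ^ (e + 2 * m)) • ⁅X, Y⁆ + ((ℓ : ℤ_[ℓ]) ^ (e + 2 * m)) • ⁅X', Y'⁆ := by
    intro g hg
    choose D hD using theta_mem_of_mem_ball hℓ hg
    have hgD : theta₁ ℓ g = ((ℓ : ℤ_[ℓ]) ^ (e + 2 * m)) • Matrix.of D := Matrix.ext hD
    have ht := trace_theta hℓ g
    rw [hgD, Matrix.trace_smul, smul_eq_mul,
      mul_eq_zero_iff_left (pow_ne_zero _ natCast_ne_zero')] at ht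
    obtain ⟨X, Y, X', Y', hX, hY, hX', hY', e'⟩ := exists_lie_add_lie_eq hℓ ht
    exact ⟨X, Y, X', Y', hX, hY, hX', hY', by rw [hgD, e', smul_add]⟩
  obtain ⟨X, Y, X', Y', hX, hY, hX', hY', e₁⟩ := main h.1 (mem_ball₂.1 hh).1
  obtain ⟨U, W, U', W', hU, hW, hU', hW', e₂⟩ := main h.2 (mem_ball₂.1 hh).2
  convert Submodule.add_mem _ (Submodule.add_mem _ (lie₁ X Y hX hY) (lie₁ X' Y' hX' hY'))
    (Submodule.add_mem _ (lie₂ U W hU hW) (lie₂ U' W' hU' hW')) using 1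
  ext1
  · simpa [theta₂] using e₁
  · simpa [theta₂] using e₂

end Openness

/-! ### Size of the projections of `𝓛(N)` and of the algebra spanned by `N`. -/

section Spans

variable {G : Subgroup (SLpair ℓ)} {n : ℕ}

/-- Powers are linear only on `1 + xV` with `V` nilpotent, so lifts are available only for such `V`;
three of them span the traceless matrices. -/
theorem traceless_eq_nilpotents (a b c : ℤ_[ℓ]) : (!![a, b; c, -a] : Mat ℓ) =
    (-a) • !![-1, 1; -1, 1] + (b + a) • !![0, 1; 0, 0] + (c - a) • !![0, 0; 1, 0] := by
  ext i j
  fin_cases i <;> fin_cases j <;> simp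

theorem exists_lieAlg_proj (hℓ : 2 < ℓ) {p : SLpair ℓ →* SL(2, ℤ_[ℓ])}
    {q : MatPair ℓ →ₗ[ℤ_[ℓ]] Mat ℓ} (hpq : ∀ z, q (theta₂ ℓ z) = theta₁ ℓ (p z))
    (hG : ball ℓ n ≤ G.map p) (Y : Mat ℓ) (hY : Y.trace = 0) :
    ∃ Z ∈ lieAlg ℓ (G ⊓ ball₂ ℓ 1 1), q Z = ((ℓ : ℤ_[ℓ]) ^ (n + 1)) • Y := by
  obtain ⟨v, hv⟩ := (isUnit_natCast (not_dvd_card_factor hℓ)).exists_right_inv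
  have nil : ∀ (V : Mat ℓ), V.trace = 0 → V.det = 0 →
      ∃ Z ∈ lieAlg ℓ (G ⊓ ball₂ ℓ 1 1), q Z = ((ℓ : ℤ_[ℓ]) ^ (n + 1)) • V := by
    intro V ht hd
    obtain ⟨z, hz, hzV⟩ := exists_mem_inf_ball_coe_eq hG ht hd
    refine ⟨v • theta₂ ℓ z, Submodule.smul_mem _ _ (theta₂_mem_lieAlg hz), ?_⟩
    rw [map_smul, hpq, theta_of_coe_eq hℓ (s := 1) _ (by rw [one_smul]; exact hzV), smul_smul]
    · congr 1
      linear_combination (ℓ : ℤ_[ℓ]) ^ (n + 1) * hv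
    · rw [Matrix.trace_smul, ht, smul_zero]
  obtain ⟨a, b, c, rfl⟩ := exists_eq_of_trace_zero hY
  obtain ⟨Z₁, hZ₁, e₁⟩ := nil !![-1, 1; -1, 1] (by simp [Matrix.trace_fin_two])
    (by simp [Matrix.det_fin_two])
  obtain ⟨Z₂, hZ₂, e₂⟩ := nil !![0, 1; 0, 0] (by simp [Matrix.trace_fin_two])
    (by simp [Matrix.det_fin_two])
  obtain ⟨Z₃, hZ₃, e₃⟩ := nil !![0, 0; 1, 0] (by simp [Matrix.trace_fin_two])
    (by simp [Matrix.det_fin_two])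
  refine ⟨(-a) • Z₁ + (b + a) • Z₂ + (c - a) • Z₃, Submodule.add_mem _ (Submodule.add_mem _
    (Submodule.smul_mem _ _ hZ₁) (Submodule.smul_mem _ _ hZ₂)) (Submodule.smul_mem _ _ hZ₃), ?_⟩
  rw [traceless_eq_nilpotents, map_add, map_add, map_smul, map_smul, map_smul, e₁, e₂, e₃]
  module

/-- The inclusion of `SL₂(ℤ_ℓ)²` in `M₂(ℤ_ℓ)²`. -/
noncomputable def coePair (ℓ : ℕ) [Fact ℓ.Prime] : SLpair ℓ →* MatPair ℓ where
  toFun x := (x.1.1, x.2.1)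
  map_one' := rfl
  map_mul' _ _ := rfl

/-- The algebra spanned by a subgroup of `SL₂(ℤ_ℓ)²`. -/
noncomputable def spanAlg (Γ : Subgroup (SLpair ℓ)) : Subalgebra ℤ_[ℓ] (MatPair ℓ) :=
  Algebra.adjoin ℤ_[ℓ] (Γ.toSubmonoid.map (coePair ℓ) : Set (MatPair ℓ))

theorem coePair_mem_spanAlg {Γ : Subgroup (SLpair ℓ)} {x : SLpair ℓ} (hx : x ∈ Γ) :
    coePair ℓ x ∈ spanAlg Γ :=
  Algebra.subset_adjoin ⟨x, hx, rfl⟩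

theorem spanAlg_induction {Γ : Subgroup (SLpair ℓ)} {p : MatPair ℓ → Prop}
    (mem : ∀ x ∈ Γ, p (coePair ℓ x)) (zero : p 0) (add : ∀ X Y, p X → p Y → p (X + Y))
    (smul : ∀ (c : ℤ_[ℓ]) X, p X → p (c • X)) {X : MatPair ℓ} (hX : X ∈ spanAlg Γ) : p X := by
  -- A group is multiplicatively closed, so the algebra it generates is just its linear span.
  rw [← Subalgebra.mem_toSubmodule, spanAlg, Algebra.adjoin_eq_span, Submonoid.closure_eq] at hX
  induction hX using Submodule.span_induction with
  | zero => exact zero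
  | add X Y _ _ h h' => exact add X Y h h'
  | smul c X _ h => exact smul c X h
  | mem _ h =>
    obtain ⟨x, hx, rfl⟩ := h
    exact mem x hx

theorem exists_spanAlg_proj (hℓ : 2 < ℓ) {p : SLpair ℓ →* SL(2, ℤ_[ℓ])}
    {q : MatPair ℓ →ₗ[ℤ_[ℓ]] Mat ℓ} (hpq : ∀ z, q (coePair ℓ z) = (p z).1)
    (hG : ball ℓ n ≤ G.map p) (Y : Mat ℓ) :
    ∃ r ∈ spanAlg (G ⊓ ball₂ ℓ 1 1), q r = ((ℓ : ℤ_[ℓ]) ^ (n + 1)) • Y := by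
  obtain ⟨v, hv⟩ := (isUnit_natCast (not_dvd_card_factor hℓ)).exists_right_inv
  have hone : q 1 = 1 := by simpa using hpq 1
  have nil : ∀ (V : Mat ℓ), V.trace = 0 → V.det = 0 →
      ∃ r ∈ spanAlg (G ⊓ ball₂ ℓ 1 1), q r = ((ℓ : ℤ_[ℓ]) ^ (n + 1)) • V := by
    intro V ht hd
    obtain ⟨z, hz, hzV⟩ := exists_mem_inf_ball_coe_eq hG ht hd
    refine ⟨v • (coePair ℓ z - 1), Subalgebra.smul_mem _ (Subalgebra.sub_mem _
      (coePair_mem_spanAlg hz) (Subalgebra.one_mem _)) _, ?_⟩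
    rw [map_smul, map_sub, hpq, hone, hzV, add_sub_cancel_left, smul_smul]
    congr 1
    linear_combination (ℓ : ℤ_[ℓ]) ^ (n + 1) * hv
  obtain ⟨t, a, b, c, rfl⟩ : ∃ t a b c : ℤ_[ℓ], Y = t • (1 : Mat ℓ) + !![a, b; c, -a] := by
    have h2 := half_mul_two hℓ
    obtain ⟨a, b, c, hY⟩ := exists_eq_of_trace_zero (X := Y - (Ring.inverse 2 * Y.trace) • 1) (by
      rw [Matrix.trace_sub, Matrix.trace_smul, Matrix.trace_one]
      simp only [Fintype.card_fin, smul_eq_mul, Nat.cast_ofNat]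
      linear_combination -Y.trace * h2)
    exact ⟨_, a, b, c, by rw [← hY, add_sub_cancel]⟩
  obtain ⟨Z₁, hZ₁, e₁⟩ := nil !![-1, 1; -1, 1] (by simp [Matrix.trace_fin_two])
    (by simp [Matrix.det_fin_two])
  obtain ⟨Z₂, hZ₂, e₂⟩ := nil !![0, 1; 0, 0] (by simp [Matrix.trace_fin_two])
    (by simp [Matrix.det_fin_two])
  obtain ⟨Z₃, hZ₃, e₃⟩ := nil !![0, 0; 1, 0] (by simp [Matrix.trace_fin_two])
    (by simp [Matrix.det_fin_two])
  refine ⟨((ℓ : ℤ_[ℓ]) ^ (n + 1) * t) • 1 +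
    ((-a) • Z₁ + (b + a) • Z₂ + (c - a) • Z₃), ?_, ?_⟩
  · exact Subalgebra.add_mem _ (Subalgebra.smul_mem _ (Subalgebra.one_mem _) _)
      (Subalgebra.add_mem _ (Subalgebra.add_mem _ (Subalgebra.smul_mem _ hZ₁ _)
        (Subalgebra.smul_mem _ hZ₂ _)) (Subalgebra.smul_mem _ hZ₃ _))
  · rw [traceless_eq_nilpotents, map_add, map_add, map_add, map_smul, map_smul, map_smul,
      map_smul, e₁, e₂, e₃, hone]
    module

end Spans

/-! ### Entrywise divisibility of matrices. -/

section Divisibility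

/-- All entries of the matrix are divisible by `ℓ ^ k`. -/
def DvdPow (k : ℕ) (X : Mat ℓ) : Prop := ∃ D : Mat ℓ, X = ((ℓ : ℤ_[ℓ]) ^ k) • D

theorem dvdPow_iff {k : ℕ} {X : Mat ℓ} : DvdPow k X ↔ ∀ i j, (ℓ : ℤ_[ℓ]) ^ k ∣ X i j := by
  constructor
  · rintro ⟨D, rfl⟩ i j
    exact ⟨D i j, rfl⟩
  · intro h
    choose D hD using h
    exact ⟨Matrix.of D, Matrix.ext hD⟩

theorem DvdPow.add {k : ℕ} {X Y : Mat ℓ} (hX : DvdPow k X) (hY : DvdPow k Y) :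
    DvdPow k (X + Y) := by
  obtain ⟨D, rfl⟩ := hX
  obtain ⟨D', rfl⟩ := hY
  exact ⟨D + D', by rw [smul_add]⟩

theorem DvdPow.sub {k : ℕ} {X Y : Mat ℓ} (hX : DvdPow k X) (hY : DvdPow k Y) :
    DvdPow k (X - Y) := by
  obtain ⟨D, rfl⟩ := hX
  obtain ⟨D', rfl⟩ := hY
  exact ⟨D - D', by rw [smul_sub]⟩

theorem DvdPow.mul_left {k : ℕ} {X : Mat ℓ} (hX : DvdPow k X) (Y : Mat ℓ) : DvdPow k (Y * X) := by
  obtain ⟨D, rfl⟩ := hX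
  exact ⟨Y * D, by rw [mul_smul_comm]⟩

theorem DvdPow.mul_right {k : ℕ} {X : Mat ℓ} (hX : DvdPow k X) (Y : Mat ℓ) : DvdPow k (X * Y) := by
  obtain ⟨D, rfl⟩ := hX
  exact ⟨D * Y, by rw [smul_mul_assoc]⟩

theorem DvdPow.mono {j k : ℕ} (hjk : j ≤ k) {X : Mat ℓ} (hX : DvdPow k X) : DvdPow j X :=
  dvdPow_iff.2 fun i l => (pow_dvd_pow _ hjk).trans (dvdPow_iff.1 hX i l)

theorem DvdPow.trace {k : ℕ} {X : Mat ℓ} (hX : DvdPow k X) : (ℓ : ℤ_[ℓ]) ^ k ∣ X.trace := by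
  obtain ⟨D, rfl⟩ := hX
  exact ⟨D.trace, by rw [Matrix.trace_smul, smul_eq_mul]⟩

end Divisibility

/-! ### The sign character of `G` and its kernel. -/

section Signs

/-- `A` has nearly equal traces in the two components, and both its projections are large. -/
structure NearlyDiagonal (A : Subalgebra ℤ_[ℓ] (MatPair ℓ)) (e m : ℕ) : Prop where
  trace_dvd : ∀ r ∈ A, (ℓ : ℤ_[ℓ]) ^ e ∣ r.1.trace - r.2.trace
  fst : ∀ Y : Mat ℓ, ∃ r ∈ A, r.1 = ((ℓ : ℤ_[ℓ]) ^ m) • Y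
  snd : ∀ Y : Mat ℓ, ∃ r ∈ A, r.2 = ((ℓ : ℤ_[ℓ]) ^ m) • Y

variable {A : Subalgebra ℤ_[ℓ] (MatPair ℓ)} {e m : ℕ}

/-- The first component nearly determines the second, by nondegeneracy of the trace form: pairing
with multiples of matrix units reads off each entry of `q.2`. -/
theorem NearlyDiagonal.dvdPow_snd (hA : NearlyDiagonal A e m) (hme : m ≤ e) {q : MatPair ℓ}
    (hq : q ∈ A) (hq₁ : q.1 = 0) : DvdPow (e - m) q.2 := by
  rw [dvdPow_iff]
  intro i j
  obtain ⟨r, hr, hr₂⟩ := hA.snd (Matrix.single j i 1)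
  have h := hA.trace_dvd _ (A.mul_mem hq hr)
  have ht : (q.2 * Matrix.single j i (1 : ℤ_[ℓ])).trace = q.2 i j := by
    rw [Matrix.trace_fin_two]
    fin_cases i <;> fin_cases j <;> simp [Matrix.mul_apply, Matrix.single_apply]
  rw [Prod.fst_mul, Prod.snd_mul, hq₁, hr₂, zero_mul, Matrix.trace_zero, mul_smul_comm,
    Matrix.trace_smul, ht, zero_sub, dvd_neg, smul_eq_mul] at h
  exact pow_dvd_of_pow_dvd_mul hme h

/-- An integer whose square is close to `ℓ ^ (2 m)` is close to `± ℓ ^ m`. -/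
theorem exists_sign_of_sq (hℓ : 2 < ℓ) {f : ℕ} (hf : 2 * m < f) {x : ℤ_[ℓ]}
    (hx : (ℓ : ℤ_[ℓ]) ^ f ∣ x ^ 2 - (ℓ : ℤ_[ℓ]) ^ (2 * m)) :
    ∃ χ : ℤ_[ℓ], (χ = 1 ∨ χ = -1) ∧ (ℓ : ℤ_[ℓ]) ^ (f - m) ∣ x - χ * (ℓ : ℤ_[ℓ]) ^ m := by
  have hsq : ((ℓ : ℤ_[ℓ]) ^ m) ^ 2 ∣ x ^ 2 := by
    have := dvd_add ((pow_dvd_pow _ hf.le).trans hx) (dvd_refl ((ℓ : ℤ_[ℓ]) ^ (2 * m)))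
    rwa [sub_add_cancel, mul_comm 2 m, pow_mul] at this
  rw [IsIntegrallyClosed.pow_dvd_pow_iff two_ne_zero] at hsq
  obtain ⟨y, rfl⟩ := hsq
  have hy : (ℓ : ℤ_[ℓ]) ^ (f - 2 * m) ∣ (y - 1) * (y + 1) := by
    refine pow_dvd_of_pow_dvd_mul hf.le ?_
    convert hx using 1
    rw [mul_comm 2 m, pow_mul]; ring
  have hy1 : (ℓ : ℤ_[ℓ]) ∣ (y - 1) * (y + 1) := (dvd_pow_self _ (by omega)).trans hy
  have split : (ℓ : ℤ_[ℓ]) ^ (f - m) = (ℓ : ℤ_[ℓ]) ^ m * (ℓ : ℤ_[ℓ]) ^ (f - 2 * m) := by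
    rw [← pow_add]; congr 1; omega
  rcases PadicInt.prime_p.dvd_or_dvd hy1 with h | h
  · refine ⟨1, Or.inl rfl, ?_⟩
    rw [(isUnit_one_add hℓ h).dvd_mul_right] at hy
    rw [split]
    convert mul_dvd_mul_left ((ℓ : ℤ_[ℓ]) ^ m) hy using 1; ring
  · refine ⟨-1, Or.inr rfl, ?_⟩
    have hu : IsUnit (y - 1) := by
      have := (isUnit_one_add hℓ (v := -y) (by convert h.neg_right using 1; ring)).neg
      convert this using 1; ring
    rw [hu.dvd_mul_left] at hy
    rw [split]
    convert mul_dvd_mul_left ((ℓ : ℤ_[ℓ]) ^ m) hy using 1; ring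

theorem two_mul_det {K : Type*} [CommRing K] (X : Matrix (Fin 2) (Fin 2) K) :
    2 * X.det = X.trace ^ 2 - (X * X).trace := by
  rw [Matrix.det_fin_two, Matrix.trace_fin_two, Matrix.trace_fin_two]
  simp only [Matrix.mul_apply, Fin.sum_univ_two]
  ring

theorem NearlyDiagonal.det_dvd (hℓ : 2 < ℓ) (hA : NearlyDiagonal A e m) {r : MatPair ℓ}
    (hr : r ∈ A) : (ℓ : ℤ_[ℓ]) ^ e ∣ r.1.det - r.2.det := by
  rw [← (isUnit_two hℓ).dvd_mul_left, mul_sub, two_mul_det, two_mul_det]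
  have h₁ := hA.trace_dvd r hr
  have h₂ := hA.trace_dvd _ (A.mul_mem hr hr)
  rw [Prod.fst_mul, Prod.snd_mul] at h₂
  convert dvd_sub (h₁.mul_right (r.1.trace + r.2.trace)) h₂ using 1
  ring

/-- `t` is, up to the sign `χ` in the second component, approximated by an element of `A`. -/
def HasSign (A : Subalgebra ℤ_[ℓ] (MatPair ℓ)) (m f : ℕ) (t : SLpair ℓ) (χ : ℤ_[ℓ]) : Prop :=
  ∃ r ∈ A, r.1 = ((ℓ : ℤ_[ℓ]) ^ m) • t.1.1 ∧ DvdPow f (r.2 - (χ * (ℓ : ℤ_[ℓ]) ^ m) • t.2.1)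

/-- With `r₁ = ℓ ^ m t₁`, the element `r z - (t z t⁻¹) r` vanishes in the first component, hence
nearly in the second. So `w = t₂⁻¹ r₂` nearly commutes with every matrix and is nearly scalar;
comparing determinants, its square is nearly `ℓ ^ (2m)`. -/
theorem NearlyDiagonal.exists_hasSign (hℓ : 2 < ℓ) (hA : NearlyDiagonal A e m) (hme : 4 * m < e)
    {t : SLpair ℓ} (ht : ∀ z ∈ A, coePair ℓ t * z * coePair ℓ t⁻¹ ∈ A) :
    ∃ χ : ℤ_[ℓ], (χ = 1 ∨ χ = -1) ∧ HasSign A m (e - 3 * m) t χ := by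
  obtain ⟨r, hr, hr₁⟩ := hA.fst t.1.1
  have inv₁ : (t⁻¹).1.1 * t.1.1 = 1 := congrArg Subtype.val (inv_mul_cancel t.1)
  have inv₂ : (t⁻¹).2.1 * t.2.1 = 1 := congrArg Subtype.val (inv_mul_cancel t.2)
  have inv₃ : t.2.1 * (t⁻¹).2.1 = 1 := congrArg Subtype.val (mul_inv_cancel t.2)
  set w : Mat ℓ := (t⁻¹).2.1 * r.2 with hw
  have hrw : r.2 = t.2.1 * w := by rw [hw, ← mul_assoc, inv₃, one_mul]
  have comm : ∀ Y : Mat ℓ, ∀ i j, (ℓ : ℤ_[ℓ]) ^ (e - 2 * m) ∣ (w * Y - Y * w) i j := by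
    intro Y i j
    obtain ⟨z, hz, hz₂⟩ := hA.snd Y
    have hq := hA.dvdPow_snd (by omega)
      (A.sub_mem (A.mul_mem hr hz) (A.mul_mem (ht z hz) hr)) (by
        change r.1 * z.1 - t.1.1 * z.1 * (t⁻¹).1.1 * r.1 = 0
        rw [hr₁, smul_mul_assoc, mul_smul_comm, mul_assoc _ _ t.1.1, inv₁, mul_one, sub_self])
    have hq' := dvdPow_iff.1 (hq.mul_left (t⁻¹).2.1) i j
    have e' : (t⁻¹).2.1 * (r * z - coePair ℓ t * z * coePair ℓ t⁻¹ * r).2 =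
        ((ℓ : ℤ_[ℓ]) ^ m) • (w * Y - Y * w) := by
      change (t⁻¹).2.1 * (r.2 * z.2 - t.2.1 * z.2 * (t⁻¹).2.1 * r.2) = _
      rw [hz₂, hw, mul_sub, ← mul_assoc, ← mul_assoc, ← mul_assoc, ← mul_assoc, inv₂, one_mul,
        mul_smul_comm, smul_mul_assoc, smul_mul_assoc, smul_sub, mul_assoc Y]
    rw [e', Matrix.smul_apply, smul_eq_mul] at hq'
    have := pow_dvd_of_pow_dvd_mul (by omega) hq'
    rwa [show e - m - m = e - 2 * m by omega] at this
  simp only [Matrix.sub_apply, Matrix.mul_apply, Fin.sum_univ_two] at comm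
  have h₁ : (ℓ : ℤ_[ℓ]) ^ (e - 2 * m) ∣ w 1 0 := by
    simpa using comm !![0, 1; 0, 0] 1 1
  have h₂ : (ℓ : ℤ_[ℓ]) ^ (e - 2 * m) ∣ w 0 0 - w 1 1 := by
    simpa using comm !![0, 1; 0, 0] 0 1
  have h₃ : (ℓ : ℤ_[ℓ]) ^ (e - 2 * m) ∣ w 0 1 := by
    simpa using comm !![0, 0; 1, 0] 0 0
  have hdet : (ℓ : ℤ_[ℓ]) ^ (e - 2 * m) ∣ (ℓ : ℤ_[ℓ]) ^ (2 * m) - w.det := by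
    have h := (pow_dvd_pow _ (Nat.sub_le e (2 * m))).trans (hA.det_dvd hℓ hr)
    have ht₁ : t.1.1.det = 1 := t.1.2
    have ht₂ : t.2.1.det = 1 := t.2.2
    rwa [hrw, hr₁, Matrix.det_smul, Matrix.det_mul, ht₁, ht₂, one_mul, mul_one, Fintype.card_fin,
      ← pow_mul, mul_comm m 2] at h
  obtain ⟨χ, hχ, hx⟩ := exists_sign_of_sq hℓ (m := m) (f := e - 2 * m) (x := w 0 0) (by omega) (by
    rw [Matrix.det_fin_two] at hdet
    convert dvd_add (dvd_sub (h₂.mul_left (w 0 0)) hdet) (h₁.mul_left (w 0 1)) using 1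
    ring)
  rw [show e - 2 * m - m = e - 3 * m by omega] at hx
  refine ⟨χ, hχ, r, hr, hr₁, ?_⟩
  have hd : DvdPow (e - 3 * m) (w - (χ * (ℓ : ℤ_[ℓ]) ^ m) • 1) := by
    have hle : (ℓ : ℤ_[ℓ]) ^ (e - 3 * m) ∣ (ℓ : ℤ_[ℓ]) ^ (e - 2 * m) := pow_dvd_pow _ (by omega)
    rw [dvdPow_iff]
    intro i j
    fin_cases i <;> fin_cases j <;> simp
    · exact hx
    · exact hle.trans h₃
    · exact hle.trans h₁
    · convert dvd_sub hx (hle.trans h₂) using 1; ring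
  convert hd.mul_left t.2.1 using 1
  rw [mul_sub, ← hrw, mul_smul_comm, mul_one]

/-- The element `ℓ ^ m r'' - r r'` of `A` has zero first component, so `(χ'' - χχ') ℓ ^ (2m)` is
divisible by `ℓ ^ f`. A nonzero difference of signs is `± 2`, a unit, which contradicts `2m < f`.
Taking `t' = 1` also gives uniqueness of the sign. -/
theorem NearlyDiagonal.sign_mul (hℓ : 2 < ℓ) (hA : NearlyDiagonal A e m) {f : ℕ} (hme : m ≤ e)
    (hf : f ≤ e - m) (hfm : 2 * m < f) {t t' : SLpair ℓ} {χ χ' χ'' : ℤ_[ℓ]}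
    (hχ : χ = 1 ∨ χ = -1) (hχ' : χ' = 1 ∨ χ' = -1) (hχ'' : χ'' = 1 ∨ χ'' = -1)
    (h : HasSign A m f t χ) (h' : HasSign A m f t' χ') (h'' : HasSign A m f (t * t') χ'') :
    χ'' = χ * χ' := by
  obtain ⟨r, hr, hr₁, hr₂⟩ := h
  obtain ⟨r', hr', hr'₁, hr'₂⟩ := h'
  obtain ⟨r'', hr'', hr''₁, hr''₂⟩ := h''
  have hq := hA.dvdPow_snd hme
    (A.sub_mem (A.smul_mem hr'' ((ℓ : ℤ_[ℓ]) ^ m)) (A.mul_mem hr hr')) (by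
      change ((ℓ : ℤ_[ℓ]) ^ m) • r''.1 - r.1 * r'.1 = 0
      rw [hr₁, hr'₁, hr''₁, smul_mul_smul_comm, smul_smul]
      exact sub_self _)
  set g := (t * t').2 with hg
  have hg' : g.1 = t.2.1 * t'.2.1 := rfl
  have key : DvdPow f (((χ'' - χ * χ') * (ℓ : ℤ_[ℓ]) ^ (2 * m)) • g.1) := by
    have h₁ : DvdPow f (((ℓ : ℤ_[ℓ]) ^ m) • r''.2 - r.2 * r'.2) := hq.mono hf
    have h₂ := hr''₂.mul_left (((ℓ : ℤ_[ℓ]) ^ m) • 1)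
    have h₃ := (hr₂.mul_right r'.2).add (hr'₂.mul_left ((χ * (ℓ : ℤ_[ℓ]) ^ m) • t.2.1))
    convert (h₁.sub h₂).add h₃ using 1
    change _ = ((ℓ : ℤ_[ℓ]) ^ m) • r''.2 - r.2 * r'.2 - ((ℓ : ℤ_[ℓ]) ^ m) • (1 : Mat ℓ) *
      (r''.2 - (χ'' * (ℓ : ℤ_[ℓ]) ^ m) • g.1) + _
    rw [hg', two_mul, pow_add]
    simp only [mul_sub, sub_mul, smul_mul_assoc, mul_smul_comm, one_mul]
    module
  have key' := dvdPow_iff.1 (key.mul_right (g⁻¹).1) 0 0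
  have hgi : g.1 * (g⁻¹).1 = 1 := congrArg Subtype.val (mul_inv_cancel g)
  rw [smul_mul_assoc, hgi] at key'
  simp only [Matrix.smul_apply, Matrix.one_apply_eq, smul_eq_mul, mul_one] at key'
  by_contra hne
  have hunit : IsUnit (χ'' - χ * χ') := by
    have h2 := isUnit_two hℓ
    have h : χ'' - χ * χ' = 2 ∨ χ'' - χ * χ' = -2 := by
      rcases hχ with rfl | rfl <;> rcases hχ' with rfl | rfl <;> rcases hχ'' with rfl | rfl <;>
        first
        | exact absurd (by ring1) hne
        | exact Or.inl (by ring1)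
        | exact Or.inr (by ring1)
    rcases h with h | h <;> rw [h]
    · exact h2
    · exact h2.neg
  rw [mul_comm] at key'
  have := le_of_pow_dvd_pow_mul_unit hunit key'
  omega

theorem hasSign_one (f : ℕ) : HasSign A m f 1 1 :=
  ⟨((ℓ : ℤ_[ℓ]) ^ m) • 1, A.smul_mem A.one_mem _, rfl, ⟨0, by
    change ((ℓ : ℤ_[ℓ]) ^ m) • (1 : Mat ℓ) - (1 * (ℓ : ℤ_[ℓ]) ^ m) • (1 : Mat ℓ) = _
    rw [one_mul, sub_self, smul_zero]⟩⟩

theorem hasSign_of_mem {t : SLpair ℓ} (ht : coePair ℓ t ∈ A) (f : ℕ) : HasSign A m f t 1 :=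
  ⟨((ℓ : ℤ_[ℓ]) ^ m) • coePair ℓ t, A.smul_mem ht _, rfl, ⟨0, by
    change ((ℓ : ℤ_[ℓ]) ^ m) • t.2.1 - (1 * (ℓ : ℤ_[ℓ]) ^ m) • t.2.1 = _
    rw [one_mul, sub_self, smul_zero]⟩⟩

/-- The elements of `G` of sign `1` form a subgroup of index at most `2`. -/
theorem NearlyDiagonal.exists_subgroup (hℓ : 2 < ℓ) (hA : NearlyDiagonal A e m) (hme : 5 * m < e)
    {G : Subgroup (SLpair ℓ)} (hG : ∀ t ∈ G, ∀ z ∈ A, coePair ℓ t * z * coePair ℓ t⁻¹ ∈ A) :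
    ∃ T : Subgroup (SLpair ℓ), T.relIndex G ∣ 2 ∧
      ∀ t, t ∈ T ↔ t ∈ G ∧ HasSign A m (e - 3 * m) t 1 := by
  have ex : ∀ t ∈ G, ∃ χ : ℤ_[ℓ], (χ = 1 ∨ χ = -1) ∧ HasSign A m (e - 3 * m) t χ :=
    fun t ht => hA.exists_hasSign hℓ (by omega) (hG t ht)
  have mul : ∀ {t t' : SLpair ℓ} {χ χ' χ'' : ℤ_[ℓ]}, (χ = 1 ∨ χ = -1) → (χ' = 1 ∨ χ' = -1) →
      (χ'' = 1 ∨ χ'' = -1) → HasSign A m (e - 3 * m) t χ → HasSign A m (e - 3 * m) t' χ' →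
      HasSign A m (e - 3 * m) (t * t') χ'' → χ'' = χ * χ' :=
    fun h₁ h₂ h₃ => hA.sign_mul hℓ (by omega) (by omega) (by omega) h₁ h₂ h₃
  let T : Subgroup (SLpair ℓ) :=
    { carrier := {t | t ∈ G ∧ HasSign A m (e - 3 * m) t 1}
      one_mem' := ⟨G.one_mem, hasSign_one _⟩
      mul_mem' := by
        rintro t t' ⟨ht, hs⟩ ⟨ht', hs'⟩
        obtain ⟨χ, hχ, h⟩ := ex _ (G.mul_mem ht ht')
        have := mul (Or.inl rfl) (Or.inl rfl) hχ hs hs' h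
        rw [one_mul] at this
        exact ⟨G.mul_mem ht ht', this ▸ h⟩
      inv_mem' := by
        rintro t ⟨ht, hs⟩
        obtain ⟨χ, hχ, h⟩ := ex _ (G.inv_mem ht)
        have := mul (t := t) (t' := t⁻¹) (Or.inl rfl) hχ (Or.inl rfl) hs h
          (by rw [mul_inv_cancel]; exact hasSign_one _)
        rw [one_mul] at this
        exact ⟨G.inv_mem ht, this ▸ h⟩ }
  have hT : ∀ t, t ∈ T ↔ t ∈ G ∧ HasSign A m (e - 3 * m) t 1 := fun t => Iff.rfl
  refine ⟨T, ?_, hT⟩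
  by_cases hle : G ≤ T
  · rw [Subgroup.relIndex_eq_one.2 hle]; exact one_dvd 2
  · obtain ⟨a, ha, haT⟩ := Set.not_subset.1 hle
    have ha' : HasSign A m (e - 3 * m) a (-1) := by
      obtain ⟨χ, rfl | rfl, h⟩ := ex a ha
      · exact absurd ((hT a).2 ⟨ha, h⟩) haT
      · exact h
    have hne : (1 : ℤ_[ℓ]) ≠ -1 := by
      intro h
      have h2 := (isUnit_two hℓ).ne_zero
      exact h2 (by linear_combination h)
    refine dvd_of_eq (Subgroup.index_eq_two_iff.2 ⟨⟨a, ha⟩, fun b => ?_⟩)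
    rw [Subgroup.mem_subgroupOf, Subgroup.mem_subgroupOf]
    change Xor (b.1 * a ∈ T) (b.1 ∈ T)
    obtain ⟨χ, hχ, h⟩ := ex b.1 b.2
    rcases hχ with rfl | rfl
    · refine Or.inr ⟨(hT _).2 ⟨b.2, h⟩, fun hba => ?_⟩
      have := mul (Or.inl rfl) (Or.inr rfl) (Or.inl rfl) h ha' ((hT _).1 hba).2
      rw [one_mul] at this
      exact hne this
    · refine Or.inl ⟨?_, fun hb => ?_⟩
      · obtain ⟨χ, hχ, h'⟩ := ex _ (G.mul_mem b.2 ha)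
        have := mul (Or.inr rfl) (Or.inr rfl) hχ h ha' h'
        rw [neg_mul_neg, one_mul] at this
        exact (hT _).2 ⟨G.mul_mem b.2 ha, this ▸ h'⟩
      · have := mul (t := b.1) (t' := 1) (Or.inr rfl) (Or.inl rfl) (Or.inl rfl) h (hasSign_one _)
          (by rw [mul_one]; exact ((hT _).1 hb).2)
        rw [mul_one] at this
        exact hne this

theorem NearlyDiagonal.trace_mul_dvd (hA : NearlyDiagonal A e m) {f : ℕ} (hf : f ≤ e)
    {t : SLpair ℓ} (ht : HasSign A m f t 1) {z : MatPair ℓ} (hz : z ∈ A) :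
    (ℓ : ℤ_[ℓ]) ^ f ∣ (ℓ : ℤ_[ℓ]) ^ m * ((t.1.1 * z.1).trace - (t.2.1 * z.2).trace) := by
  obtain ⟨r, hr, hr₁, hr₂⟩ := ht
  have h₁ := (pow_dvd_pow _ hf).trans (hA.trace_dvd _ (A.mul_mem hr hz))
  have h₂ := (hr₂.mul_right z.2).trace
  convert dvd_add h₁ h₂ using 1
  rw [Prod.fst_mul, Prod.snd_mul, hr₁, sub_mul, Matrix.trace_sub, smul_mul_assoc, smul_mul_assoc,
    Matrix.trace_smul, Matrix.trace_smul, smul_eq_mul, smul_eq_mul]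
  ring

/-- Replacing `t` by `Θ(t)` subtracts half the product of the traces of `t` and `z`, and each of
these traces nearly agrees in the two components. -/
theorem NearlyDiagonal.lieAlg_trace_mul_dvd (hA : NearlyDiagonal A e m) {f : ℕ}
    (hf : f ≤ e) {T : Subgroup (SLpair ℓ)} (hT : ∀ t ∈ T, HasSign A m f t 1) {z : MatPair ℓ}
    (hz : z ∈ A) {X : MatPair ℓ} (hX : X ∈ lieAlg ℓ T) :
    (ℓ : ℤ_[ℓ]) ^ f ∣ (ℓ : ℤ_[ℓ]) ^ m * ((X.1 * z.1).trace - (X.2 * z.2).trace) := by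
  induction hX using Submodule.span_induction with
  | zero => simp
  | add X X' _ _ h h' =>
    convert dvd_add h h' using 1
    rw [Prod.fst_add, Prod.snd_add, add_mul, add_mul, Matrix.trace_add, Matrix.trace_add]
    ring
  | smul c X _ h =>
    convert h.mul_left c using 1
    rw [Prod.smul_fst, Prod.smul_snd, smul_mul_assoc, smul_mul_assoc, Matrix.trace_smul,
      Matrix.trace_smul, smul_eq_mul, smul_eq_mul]
    ring
  | mem _ h =>
    obtain ⟨t, ht, rfl⟩ := h
    have h₁ := hA.trace_mul_dvd hf (hT t ht) hz
    have h₂ := hA.trace_mul_dvd hf (hT t ht) A.one_mem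
    rw [Prod.fst_one, Prod.snd_one, mul_one, mul_one] at h₂
    have h₃ := (pow_dvd_pow _ hf).trans (hA.trace_dvd z hz)
    convert dvd_sub h₁ (dvd_add (h₂.mul_left (Ring.inverse 2 * z.1.trace))
      (h₃.mul_left ((ℓ : ℤ_[ℓ]) ^ m * (Ring.inverse 2 * t.2.1.trace)))) using 1
    simp only [theta₂, theta₁, sub_mul, Matrix.trace_sub, smul_mul_assoc, one_mul,
      Matrix.trace_smul, smul_eq_mul]
    ring

theorem NearlyDiagonal.le_of_scaledSl_le (hA : NearlyDiagonal A e m) {f : ℕ}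
    (hf : f ≤ e) {T : Subgroup (SLpair ℓ)} (hT : ∀ t ∈ T, HasSign A m f t 1) {k : ℕ}
    (hk : (scaledSl ℓ k).prod (scaledSl ℓ k) ≤ lieAlg ℓ T) : f ≤ k + 2 * m := by
  -- Pairing `(ℓ ^ k E, 0)` with an element of `A` over `ℓ ^ m F` gives exactly `ℓ ^ (k + m)`; the
  -- remaining `ℓ ^ m` comes from the trace estimate.
  obtain ⟨z, hz, hz₁⟩ := hA.fst !![0, 0; 1, 0]
  have hX : ((((ℓ : ℤ_[ℓ]) ^ k) • !![0, 1; 0, 0], 0) : MatPair ℓ) ∈ lieAlg ℓ T := by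
    refine hk (Submodule.mem_prod.2 ⟨?_, Submodule.zero_mem _⟩)
    rw [scaledSl, Submodule.mem_smul_pointwise_iff_exists]
    exact ⟨!![0, 1; 0, 0], by simp [Matrix.trace_fin_two], rfl⟩
  have h := hA.lieAlg_trace_mul_dvd hf hT hz hX
  rw [hz₁] at h
  simp [Matrix.trace_fin_two] at h
  refine le_of_pow_dvd_pow_mul_unit (ℓ := ℓ) isUnit_one ?_
  convert h using 1
  ring

end Signs

/-! ### The trace precision and the dichotomy. -/

section Main

theorem exists_tau_sub_ne_zero (hℓ : 2 < ℓ) {N : Subgroup (SLpair ℓ)} {s : ℕ}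
    (hs : ball₂ ℓ s s ≤ N) : ∃ x ∈ N, tau x.1 - tau x.2 ≠ 0 := by
  obtain ⟨g, hg, hgθ⟩ := exists_theta_eq hℓ (Nat.succ_pos s)
    (X := ((ℓ : ℤ_[ℓ]) ^ (s + 1)) • !![1, 0; 0, -1]) (by simp [Matrix.trace_fin_two])
    (fun i j => by simp)
  refine ⟨(g, 1), hs (mem_ball₂.2 ⟨ball_anti (Nat.le_succ s) hg, Subgroup.one_mem _⟩), fun h => ?_⟩
  have h1 : tau (1 : SL(2, ℤ_[ℓ])) = 1 := by
    rw [tau, Matrix.SpecialLinearGroup.coe_one, Matrix.trace_one]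
    simpa using half_mul_two hℓ
  have ht : tau g = 1 := by rw [← h1]; exact sub_eq_zero.1 h
  have e := congrFun (congrFun (theta_mul_self hℓ g) 0) 0
  rw [ht, hgθ] at e
  simp at e
  exact (NeZero.ne ℓ) e

/-- The precision to which the traces of the two components agree on `N`. -/
theorem exists_trace_precision (hℓ : 2 < ℓ) {N : Subgroup (SLpair ℓ)} {s : ℕ}
    (hs : ball₂ ℓ s s ≤ N) : ∃ e : ℕ,
      (∃ x ∈ N, ∃ u : ℤ_[ℓ], IsUnit u ∧ tau x.1 - tau x.2 = (ℓ : ℤ_[ℓ]) ^ e * u) ∧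
      ∀ x ∈ N, (ℓ : ℤ_[ℓ]) ^ e ∣ tau x.1 - tau x.2 := by
  classical
  have key : ∀ x ∈ N, tau x.1 - tau x.2 ≠ 0 → ∃ x' ∈ N, ∃ u : ℤ_[ℓ], IsUnit u ∧
      tau x'.1 - tau x'.2 = (ℓ : ℤ_[ℓ]) ^ (tau x.1 - tau x.2).valuation * u := by
    intro x hx h
    refine ⟨x, hx, PadicInt.unitCoeff h, Units.isUnit _, ?_⟩
    rw [mul_comm]
    exact PadicInt.unitCoeff_spec h
  obtain ⟨x₀, hx₀, h₀⟩ := exists_tau_sub_ne_zero hℓ hs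
  have hex : ∃ e : ℕ, ∃ x ∈ N, ∃ u : ℤ_[ℓ], IsUnit u ∧ tau x.1 - tau x.2 = (ℓ : ℤ_[ℓ]) ^ e * u :=
    ⟨_, key x₀ hx₀ h₀⟩
  refine ⟨Nat.find hex, Nat.find_spec hex, fun x hx => ?_⟩
  by_cases h : tau x.1 - tau x.2 = 0
  · rw [h]; exact dvd_zero _
  · rw [PadicInt.unitCoeff_spec h]
    exact (pow_dvd_pow _ (Nat.find_min' hex (key x hx h))).mul_left _

theorem nearlyDiagonal_spanAlg (hℓ : 2 < ℓ) {G : Subgroup (SLpair ℓ)} {n e : ℕ}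
    (hG₁ : ball ℓ n ≤ G.map (MonoidHom.fst SL(2, ℤ_[ℓ]) SL(2, ℤ_[ℓ])))
    (hG₂ : ball ℓ n ≤ G.map (MonoidHom.snd SL(2, ℤ_[ℓ]) SL(2, ℤ_[ℓ])))
    (he : ∀ x ∈ G ⊓ ball₂ ℓ 1 1, (ℓ : ℤ_[ℓ]) ^ e ∣ tau x.1 - tau x.2) :
    NearlyDiagonal (spanAlg (G ⊓ ball₂ ℓ 1 1)) e (n + 1) where
  trace_dvd r hr := by
    refine spanAlg_induction (p := fun r : MatPair ℓ => (ℓ : ℤ_[ℓ]) ^ e ∣ r.1.trace - r.2.trace)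
      ?_ (by simp) ?_ ?_ hr
    · intro x hx
      convert (he x hx).mul_left 2 using 1
      change x.1.1.trace - x.2.1.trace = _
      rw [trace_eq_two_mul_tau hℓ, trace_eq_two_mul_tau hℓ]
      ring
    · intro X Y hX hY
      convert dvd_add hX hY using 1
      rw [Prod.fst_add, Prod.snd_add, Matrix.trace_add, Matrix.trace_add]
      ring
    · intro c X hX
      convert hX.mul_left c using 1
      rw [Prod.smul_fst, Prod.smul_snd, Matrix.trace_smul, Matrix.trace_smul, smul_eq_mul,
        smul_eq_mul]
      ring
  fst Y := exists_spanAlg_proj hℓ (q := LinearMap.fst _ _ _) (fun _ => rfl) hG₁ Y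
  snd Y := exists_spanAlg_proj hℓ (q := LinearMap.snd _ _ _) (fun _ => rfl) hG₂ Y

theorem conj_mem_spanAlg {G : Subgroup (SLpair ℓ)} {t : SLpair ℓ} (ht : t ∈ G) {z : MatPair ℓ}
    (hz : z ∈ spanAlg (G ⊓ ball₂ ℓ 1 1)) :
    coePair ℓ t * z * coePair ℓ t⁻¹ ∈ spanAlg (G ⊓ ball₂ ℓ 1 1) := by
  refine spanAlg_induction (p := fun z => coePair ℓ t * z * coePair ℓ t⁻¹ ∈
    spanAlg (G ⊓ ball₂ ℓ 1 1)) ?_ (by simp) ?_ ?_ hz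
  · intro x hx
    rw [← map_mul, ← map_mul]
    exact coePair_mem_spanAlg ⟨G.mul_mem (G.mul_mem ht hx.1) (G.inv_mem ht),
      (ball₂_normal 1).conj_mem x hx.2 t⟩
  · intro X Y hX hY
    rw [mul_add, add_mul]
    exact Subalgebra.add_mem _ hX hY
  · intro c X hX
    rw [mul_smul_comm, smul_mul_assoc]
    exact Subalgebra.smul_mem _ hX c

/-- A scalar matrix is determined by its trace, as 2 is invertible modulo `ℓ`. -/
theorem red_eq_of_trace_dvd (hℓ : 2 < ℓ) {x y : SL(2, ℤ_[ℓ])} (h : (ℓ : ℤ_[ℓ]) ∣ x.1.trace - y.1.trace)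
    (hx : IsScalar (red ℓ x)) (hy : IsScalar (red ℓ y)) : red ℓ x = red ℓ y := by
  obtain ⟨c, hc⟩ := hx
  obtain ⟨d, hd⟩ := hy
  have tr : ∀ (g : SL(2, ℤ_[ℓ])) (b : ZMod ℓ), (red ℓ g).1 = b • 1 →
      PadicInt.toZMod g.1.trace = 2 * b := by
    intro g b hb
    have : (red ℓ g).1.trace = PadicInt.toZMod g.1.trace := by
      rw [Matrix.trace_fin_two, Matrix.trace_fin_two, map_add]; rfl
    rw [← this, hb, Matrix.trace_smul, Matrix.trace_one]
    simp [mul_comm]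
  have htr : PadicInt.toZMod x.1.trace = PadicInt.toZMod y.1.trace := by
    rw [← sub_eq_zero, ← map_sub, ← RingHom.mem_ker, PadicInt.ker_toZMod,
      PadicInt.maximalIdeal_eq_span_p, Ideal.mem_span_singleton]
    exact h
  rw [tr x c hc, tr y d hd] at htr
  have h2 : (2 : ZMod ℓ) ≠ 0 := by
    have : ((2 : ℕ) : ZMod ℓ) ≠ 0 := by
      rw [Ne, ZMod.natCast_eq_zero_iff]
      exact fun h => absurd (Nat.le_of_dvd (by norm_num) h) (by omega)
    simpa using this
  apply Subtype.ext
  rw [hc, hd, mul_left_cancel₀ h2 htr]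

theorem one_add_smul_upper (x : ℤ_[ℓ]) : (1 : Mat ℓ) + x • !![0, 1; 0, 0] = !![1, x; 0, 1] := by
  ext i j
  fin_cases i <;> fin_cases j <;> simp

theorem one_add_smul_lower (x : ℤ_[ℓ]) : (1 : Mat ℓ) + x • !![0, 0; 1, 0] = !![1, 0; x, 1] := by
  ext i j
  fin_cases i <;> fin_cases j <;> simp

theorem trace_det_upper : (!![0, 1; 0, 0] : Mat ℓ).trace = 0 ∧ (!![0, 1; 0, 0] : Mat ℓ).det = 0 := by
  simp [Matrix.trace_fin_two, Matrix.det_fin_two]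

theorem trace_det_lower : (!![0, 0; 1, 0] : Mat ℓ).trace = 0 ∧ (!![0, 0; 1, 0] : Mat ℓ).det = 0 := by
  simp [Matrix.trace_fin_two, Matrix.det_fin_two]

theorem ball₂_le_commutator_of_proj (hℓ : 2 < ℓ) {G : Subgroup (SLpair ℓ)} {a n : ℕ} (ha : 0 < a)
    (haG : ball₂ ℓ a a ≤ G)
    (hG₁ : ball ℓ n ≤ G.map (MonoidHom.fst SL(2, ℤ_[ℓ]) SL(2, ℤ_[ℓ])))
    (hG₂ : ball ℓ n ≤ G.map (MonoidHom.snd SL(2, ℤ_[ℓ]) SL(2, ℤ_[ℓ]))) :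
    ball₂ ℓ (a + n) (a + n) ≤ ⁅G, G⁆ := by
  refine ball₂_le_commutator hℓ ha haG isUnit_one ?_ ?_ ?_ ?_ <;> rw [mul_one]
  · rw [← one_add_smul_upper]
    exact exists_mem_coe_eq hG₁ trace_det_upper.1 trace_det_upper.2
  · rw [← one_add_smul_lower]
    exact exists_mem_coe_eq hG₁ trace_det_lower.1 trace_det_lower.2
  · rw [← one_add_smul_upper]
    exact exists_mem_coe_eq hG₂ trace_det_upper.1 trace_det_upper.2
  · rw [← one_add_smul_lower]
    exact exists_mem_coe_eq hG₂ trace_det_lower.1 trace_det_lower.2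

theorem ball₂_le_commutator_of_inf_ball_le (hℓ : 2 < ℓ) {G T : Subgroup (SLpair ℓ)} {a n : ℕ}
    (ha : 0 < a) (haT : ball₂ ℓ a a ≤ T) (hT : G ⊓ ball₂ ℓ 1 1 ≤ T)
    (hG₁ : ball ℓ n ≤ G.map (MonoidHom.fst SL(2, ℤ_[ℓ]) SL(2, ℤ_[ℓ])))
    (hG₂ : ball ℓ n ≤ G.map (MonoidHom.snd SL(2, ℤ_[ℓ]) SL(2, ℤ_[ℓ]))) :
    ball₂ ℓ (a + (n + 1)) (a + (n + 1)) ≤ ⁅T, T⁆ := by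
  refine ball₂_le_commutator hℓ ha haT (isUnit_natCast (not_dvd_card_factor hℓ)) ?_ ?_ ?_ ?_
  · rw [← one_add_smul_upper]
    obtain ⟨z, hz, h⟩ := exists_mem_inf_ball_coe_eq hG₁ trace_det_upper.1 trace_det_upper.2
    exact ⟨z, hT hz, h⟩
  · rw [← one_add_smul_lower]
    obtain ⟨z, hz, h⟩ := exists_mem_inf_ball_coe_eq hG₁ trace_det_lower.1 trace_det_lower.2
    exact ⟨z, hT hz, h⟩
  · rw [← one_add_smul_upper]
    obtain ⟨z, hz, h⟩ := exists_mem_inf_ball_coe_eq hG₂ trace_det_upper.1 trace_det_upper.2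
    exact ⟨z, hT hz, h⟩
  · rw [← one_add_smul_lower]
    obtain ⟨z, hz, h⟩ := exists_mem_inf_ball_coe_eq hG₂ trace_det_lower.1 trace_det_lower.2
    exact ⟨z, hT hz, h⟩

theorem exists_lieAlg_fst (hℓ : 2 < ℓ) {G : Subgroup (SLpair ℓ)} {n : ℕ}
    (hG : ball ℓ n ≤ G.map (MonoidHom.fst SL(2, ℤ_[ℓ]) SL(2, ℤ_[ℓ]))) (Y : Mat ℓ)
    (hY : Y.trace = 0) :
    ∃ Z ∈ lieAlg ℓ (G ⊓ ball₂ ℓ 1 1), Z.1 = ((ℓ : ℤ_[ℓ]) ^ (n + 1)) • Y := by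
  obtain ⟨Z, hZ, h⟩ := exists_lieAlg_proj hℓ (p := MonoidHom.fst _ _)
    (q := LinearMap.fst ℤ_[ℓ] (Mat ℓ) (Mat ℓ)) (fun z => rfl) hG Y hY
  exact ⟨Z, hZ, h⟩

theorem exists_lieAlg_snd (hℓ : 2 < ℓ) {G : Subgroup (SLpair ℓ)} {n : ℕ}
    (hG : ball ℓ n ≤ G.map (MonoidHom.snd SL(2, ℤ_[ℓ]) SL(2, ℤ_[ℓ]))) (Y : Mat ℓ)
    (hY : Y.trace = 0) :
    ∃ Z ∈ lieAlg ℓ (G ⊓ ball₂ ℓ 1 1), Z.2 = ((ℓ : ℤ_[ℓ]) ^ (n + 1)) • Y := by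
  obtain ⟨Z, hZ, h⟩ := exists_lieAlg_proj hℓ (p := MonoidHom.snd _ _)
    (q := LinearMap.snd ℤ_[ℓ] (Mat ℓ) (Mat ℓ)) (fun z => rfl) hG Y hY
  exact ⟨Z, hZ, h⟩

theorem commutator_dichotomy (hℓ : 2 < ℓ) {G : Subgroup (SLpair ℓ)}
    (hG : IsOpen (G : Set (SLpair ℓ))) {n : ℕ} (hn : 0 < n)
    (hG₁ : ball ℓ n ≤ G.map (MonoidHom.fst SL(2, ℤ_[ℓ]) SL(2, ℤ_[ℓ])))
    (hG₂ : ball ℓ n ≤ G.map (MonoidHom.snd SL(2, ℤ_[ℓ]) SL(2, ℤ_[ℓ]))) :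
    ball₂ ℓ (20 * n) (20 * n) ≤ ⁅G, G⁆ ∨
    ∃ T : Subgroup (SLpair ℓ), T ≤ G ∧ IsOpen (T : Set (SLpair ℓ)) ∧ T.relIndex G ∣ 2 ∧
      (∀ k : ℕ, (scaledSl ℓ k).prod (scaledSl ℓ k) ≤ lieAlg ℓ T →
        ball₂ ℓ (4 * k) (4 * k) ≤ ⁅T, T⁆) ∧
      (∀ t ∈ T, IsScalar (red ℓ t.1) → IsScalar (red ℓ t.2) → red ℓ t.1 = red ℓ t.2) := by
  obtain ⟨s, hs⟩ := exists_ball₂_le hG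
  have hsN : ball₂ ℓ (s + 1) (s + 1) ≤ G ⊓ ball₂ ℓ 1 1 :=
    le_inf ((ball₂_anti (Nat.le_succ s)).trans hs) (ball₂_anti (by omega))
  obtain ⟨e, ⟨x, hx, u, hu, hxu⟩, he⟩ := exists_trace_precision hℓ hsN
  have ha : ball₂ ℓ (e + 2 * (n + 1)) (e + 2 * (n + 1)) ≤ G ⊓ ball₂ ℓ 1 1 :=
    ball₂_le_of_tau_sub hℓ inf_le_right hsN (Nat.succ_pos n)
      (exists_lieAlg_fst hℓ hG₁) (exists_lieAlg_snd hℓ hG₂) hx hu hxu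
  -- When this fails, `e ≥ 17n - 1`, which exceeds `5(n + 1)` and so makes the sign character well
  -- defined.
  by_cases hcase : e + 2 * (n + 1) + n ≤ 20 * n
  · left
    exact (ball₂_anti hcase).trans
      (ball₂_le_commutator_of_proj hℓ (by omega) (ha.trans inf_le_left) hG₁ hG₂)
  right
  have hA := nearlyDiagonal_spanAlg hℓ hG₁ hG₂ he
  obtain ⟨T, hTi, hT⟩ := hA.exists_subgroup hℓ (by omega) (G := G)
    (fun t ht z hz => conj_mem_spanAlg ht hz)
  have hNT : G ⊓ ball₂ ℓ 1 1 ≤ T :=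
    fun t ht => (hT t).2 ⟨ht.1, hasSign_of_mem (coePair_mem_spanAlg ht) _⟩
  refine ⟨T, fun t ht => ((hT t).1 ht).1,
    Subgroup.isOpen_mono (hsN.trans hNT) (isOpen_ball₂ (s + 1)), hTi, ?_, ?_⟩
  · intro k hk
    -- This says `e ≤ k + 5(n + 1)`, so the radius `e + 3(n + 1)` is at most `k + 8(n + 1)`. As `k ≥
    -- 12n - 6`, this is at most `4k`.
    have hle := hA.le_of_scaledSl_le (by omega) (fun t ht => ((hT t).1 ht).2) hk
    refine (ball₂_anti ?_).trans
      (ball₂_le_commutator_of_inf_ball_le hℓ (by omega) (ha.trans hNT) hNT hG₁ hG₂)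
    omega
  · intro t ht
    refine red_eq_of_trace_dvd hℓ ?_
    have h := hA.trace_mul_dvd (by omega) ((hT t).1 ht).2 (Subalgebra.one_mem _)
    rw [Prod.fst_one, Prod.snd_one, mul_one, mul_one] at h
    exact (dvd_pow_self _ (by omega)).trans (pow_dvd_of_pow_dvd_mul (by omega) h)

end Main

end PinkSL2

theorem mainTheorem2 (ℓ : ℕ) [Fact ℓ.Prime] (hℓ : 2 < ℓ)
    (G : Subgroup (SL(2, ℤ_[ℓ]) × SL(2, ℤ_[ℓ])))
    (hG : IsOpen (G : Set (SL(2, ℤ_[ℓ]) × SL(2, ℤ_[ℓ]))))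
    (n₁ n₂ : ℕ) (hn₁ : 0 < n₁) (hn₂ : 0 < n₂)
    (hG₁ : PinkSL2.ball ℓ n₁ ≤ G.map (MonoidHom.fst SL(2, ℤ_[ℓ]) SL(2, ℤ_[ℓ])))
    (hG₂ : PinkSL2.ball ℓ n₂ ≤ G.map (MonoidHom.snd SL(2, ℤ_[ℓ]) SL(2, ℤ_[ℓ]))) :
    PinkSL2.ball₂ ℓ (20 * max n₁ n₂) (20 * max n₁ n₂) ≤ ⁅G, G⁆ ∨
    ∃ T : Subgroup (SL(2, ℤ_[ℓ]) × SL(2, ℤ_[ℓ])),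
      T ≤ G ∧ IsOpen (T : Set (SL(2, ℤ_[ℓ]) × SL(2, ℤ_[ℓ]))) ∧
      T.relIndex G ∣ 48 ^ 2 ∧
      (∀ k : ℕ,
        (PinkSL2.scaledSl ℓ k).prod (PinkSL2.scaledSl ℓ k) ≤ PinkSL2.lieAlg ℓ T →
        PinkSL2.ball₂ ℓ (2 * k + max (2 * k) (max (8 * n₁) (8 * n₂)))
          (2 * k + max (2 * k) (max (8 * n₁) (8 * n₂))) ≤ ⁅T, T⁆) ∧
      (∀ t ∈ T, PinkSL2.IsScalar (PinkSL2.red ℓ t.1) → PinkSL2.IsScalar (PinkSL2.red ℓ t.2) →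
        PinkSL2.red ℓ t.1 = PinkSL2.red ℓ t.2) := by
  rcases PinkSL2.commutator_dichotomy hℓ hG (lt_of_lt_of_le hn₁ (le_max_left n₁ n₂))
    ((PinkSL2.ball_anti (le_max_left n₁ n₂)).trans hG₁)
    ((PinkSL2.ball_anti (le_max_right n₁ n₂)).trans hG₂) with h | ⟨T, hTG, hTo, hTi, hTk, hTs⟩
  · exact Or.inl h
  · refine Or.inr ⟨T, hTG, hTo, hTi.trans ⟨1152, by norm_num⟩, fun k hk => ?_, hTs⟩
    exact (PinkSL2.ball₂_anti (by omega)).trans (hTk k hk)
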